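/- **Area law for Krein-gapped quadratic bosonic Hamiltonians (case $H_{xp}+H_{xp}^T=0$).** Let $D\ge 1$, let $|\cdot|$ be the $\ell^1$ (lattice path) length on $\mathbb Z^D$, and consider a translationally invariant single-band quadratic bosonic Hamiltonian (one boson per site) $$H=\sum_{j,r\in\mathbb Z^D}K_r\,a_j^\dagger a_{j+r}+\tfrac12\big(\Delta_r\,a_j^\dagger a_{j+r}^\dagger+\mathrm{h.c.}\big),\qquad K_{-r}=\overline{K_r},\quad \Delta_{-r}=\Delta_r,$$ with finite range $R\ge1$ ($K_r=\Delta_r=0$ for $|r|>R$). In quadratures its couplings are the matrices $(H_{xx})_{j,j+r}=\mathrm{Re}(K_r+\Delta_r)$, $(H_{pp})_{j,j+r}=\mathrm{Re}(K_r-\Delta_r)$, $(H_{xp})_{j,j+r}=\mathrm{Im}(\Delta_r-K_r)$; let $X(k),P(k)$ be the symbols $\sum_r e^{ik\cdot r}(\cdot)_{0,r}$ of $H_{xx},H_{pp}$, and $\|H_{xx}\|=\sup_k|X(k)|$, $\|H_{pp}\|=\sup_k|P(k)|$ their operator norms on $\ell^2(\mathbb Z^D)$. Put $K(k)=\sum_r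 e^{ik\cdot r}K_r$, $\Delta(k)=\sum_r e^{ik\cdot r}\Delta_r$, $$g(k)=\begin{pmatrix}K(k)&\Delta(k)\\-\overline{\Delta(-k)}&-\overline{K(-k)}\end{pmatrix},\qquad \tau_3=\begin{pmatrix}1&0\\0&-1\end{pmatrix},\qquad \tau_1=\begin{pmatrix}0&1\\1&0\end{pmatrix}.$$ $H$ is *dynamically stable* if every $g(k)$ is diagonalizable with real spectrum. The quasiparticle energy $\omega(k)$ is the eigenvalue of $g(k)$ that has an eigenvector $v$ with $v^\dagger\tau_3v=1$, and the *Krein gap* is $\Delta_{\rm Krein}=\inf_{k\in[-\pi,\pi]^D}|\omega(k)+\omega(-k)|$. A *Bogoliubov transformation diagonalizing $H$* is a family $L(k)$ with $\overline{L(k)}=\tau_1L(-k)\tau_1$, $L(k)^\dagger\tau_3L(k)=\tau_3$, $g(k)L(k)=L(k)\,\mathrm{diag}(\omega(k),-\omega(-k))$. Its *quasiparticle vacuum* is the zero-mean Gaussian state with quadrature covariance matrix $$\Gamma_{j,j'}=\frac1{(2\pi)^D}\int_{[-\pi,\pi]^D}e^{ik\cdot(j-j')}\,U^\dagger L(k)L(k)^\dagger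 U\,dk,\qquad U=\tfrac1{\sqrt2}\begin{pmatrix}1&i\\1&-i\end{pmatrix}.$$ For finite $B\subset\mathbb Z^D$ its *entanglement entropy* is the von Neumann entropy of the reduced Gaussian state, $S_B=\sum_i\big[\tfrac{\nu_i+1}2\log\tfrac{\nu_i+1}2-\tfrac{\nu_i-1}2\log\tfrac{\nu_i-1}2\big]$, where the $\nu_i$ are the symplectic eigenvalues of the restriction of $\Gamma$ to $B$. Let $s(B)$ be the number of nearest-neighbour pairs $(i,j)$ with $i\in B$, $j\notin B$, and $\mathrm{Li}_s(z)=\sum_{n\ge1}z^n/n^s$. For $c>0$, call $\xi>0$ a *correlation length (with constant $c$)* if $|\Gamma_{x_jx_{j'}}|\le c\frac{\|H_{pp}\|}{\Delta_{\rm Krein}}e^{-|j-j'|/\xi}$ and $|\Gamma_{p_jp_{j'}}|\le c\frac{\|H_{xx}\|}{\Delta_{\rm Krein}}e^{-|j-j'|/\xi}$ for all $j,j'$. **Claim.** For every $D\ge1$ there is $c>0$, depending only on $D$, such that for all $R\ge1$ and all $H$ as above that are dynamically stable with $\Delta_{\rm Krein}>0$ and $H_{xp}+H_{xp}^T=0$: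 1. (Reduction to the harmonic case with $H_{pp}=1$.) $X(k)$ and $P(k)$ do not vanish and $X(k)/P(k)>0$ for all $k$; a Bogoliubov transformation diagonalizing $H$ exists; and for each such transformation $\Gamma=\tilde H_{xx}^{-1/2}\oplus\tilde H_{xx}^{1/2}$, where $\tilde H_{xx}=H_{xx}H_{pp}^{-1}$ has symbol $X/P$. That is, $\Gamma$ is the ground-state covariance matrix of the harmonic lattice $\tilde H_{xx}\oplus\mathbf 1$. 2. (Exponential decay.) $\xi_0=c\,R\,\sqrt{\|H_{xx}\|\,\|H_{pp}\|}\,/\,\Delta_{\rm Krein}$ is a correlation length with constant $c$. 3. (Area law.) For every correlation length $\xi$ with constant $c$, in particular for $\xi_0$, and every finite $B\subset\mathbb Z^D$, $$S_B\le16c^2\,\|H_{xx}\|\,\|H_{pp}\|\;\mathrm{Li}_{1-2D}\big(e^{-1/\xi}\big)\,\frac{s(B)}{\Delta_{\rm Krein}^2}.$$ For $H_{pp}=\mathbf 1$ this is the Cramer–Eisert bound with the many-body gap replaced by $\Delta_{\rm Krein}$. -/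

import Mathlib

open scoped Matrix ComplexConjugate

noncomputable section

namespace Krein

/-- Sites of the hypercubic lattice. -/
abbrev Site (D : ℕ) : Type := Fin D → ℤ

/-- Quasi-momenta; all momentum-space functions below are `2π`-periodic in each component. -/
abbrev Momentum (D : ℕ) : Type := Fin D → ℝ

/-- The first Brillouin zone `[-π, π]^D`. -/
def BZ (D : ℕ) : Set (Momentum D) := Set.Icc (fun _ => -Real.pi) (fun _ => Real.pi)

/-- Lattice (nearest-neighbour path) length `|r|` of a displacement. -/
def len {D : ℕ} (r : Site D) : ℕ := ∑ μ, (r μ).natAbs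

/-- The pairing `k · r`. -/
def dotK {D : ℕ} (k : Momentum D) (r : Site D) : ℝ := ∑ μ, k μ * (r μ : ℝ)

/-- A finite box that contains every displacement `r` with `|r| ≤ R`. -/
def box (D R : ℕ) : Finset (Site D) := Finset.Icc (fun _ => -(R : ℤ)) (fun _ => (R : ℤ))

/-- A translationally invariant quadratic bosonic Hamiltonian on `ℤ^D` with one boson per site and
couplings of range `R`,
`H = ∑_{j,r} K_r a_j† a_{j+r} + (1/2) (Δ_r a_j† a_{j+r}† + h.c.)`. -/
structure QBH (D R : ℕ) where
  /-- hopping amplitudes -/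
  K : Site D → ℂ
  /-- pairing amplitudes -/
  Δ : Site D → ℂ
  K_neg : ∀ r, K (-r) = conj (K r)
  Δ_neg : ∀ r, Δ (-r) = Δ r
  K_range : ∀ r, R < len r → K r = 0
  Δ_range : ∀ r, R < len r → Δ r = 0

/-- The Pauli matrix `τ₁` in Nambu space. -/
def τ₁ : Matrix (Fin 2) (Fin 2) ℂ := !![0, 1; 1, 0]

/-- The Pauli matrix `τ₃` in Nambu space. -/
def τ₃ : Matrix (Fin 2) (Fin 2) ℂ := !![1, 0; 0, -1]

/-- The change of basis from quadratures to bosonic modes, `(a, a†)ᵀ = U (x, p)ᵀ`. -/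
def quadU : Matrix (Fin 2) (Fin 2) ℂ :=
  ((Real.sqrt 2 : ℝ) : ℂ)⁻¹ • !![1, Complex.I; 1, -Complex.I]

namespace QBH

variable {D R : ℕ} (H : QBH D R)

/-- `K(k) = ∑_r e^{i k·r} K_r`. -/
def Khat (k : Momentum D) : ℂ := ∑ r ∈ box D R, Complex.exp (Complex.I * dotK k r) * H.K r

/-- `Δ(k) = ∑_r e^{i k·r} Δ_r`. -/
def Δhat (k : Momentum D) : ℂ := ∑ r ∈ box D R, Complex.exp (Complex.I * dotK k r) * H.Δ r

/-- The Bloch dynamical matrix: `[H, φ(k)] = - g(k) φ(k)`. -/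
def g (k : Momentum D) : Matrix (Fin 2) (Fin 2) ℂ :=
  !![H.Khat k, H.Δhat k; -conj (H.Δhat (-k)), -conj (H.Khat (-k))]

/-- Dynamical stability: every `g(k)` is diagonalizable with real eigenvalues. -/
def DynamicallyStable : Prop :=
  ∀ k, ∃ (S : Matrix (Fin 2) (Fin 2) ℂ) (e : Fin 2 → ℝ),
    IsUnit S.det ∧ H.g k * S = S * Matrix.diagonal (fun n => (e n : ℂ))

/-- `ω` is a quasiparticle energy at momentum `k`: an eigenvalue of `g(k)` with an eigenvector
of Krein signature `+1`, normalized as `v† τ₃ v = 1`. -/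
def IsQuasiparticleEnergy (k : Momentum D) (ω : ℝ) : Prop :=
  ∃ v : Fin 2 → ℂ, H.g k *ᵥ v = (ω : ℂ) • v ∧ star v ⬝ᵥ (τ₃ *ᵥ v) = 1

/-- The (direct) Krein gap `min_k |ω(k) + ω(-k)|`. -/
def kreinGap : ℝ :=
  sInf {x : ℝ | ∃ k ∈ BZ D, ∃ ω ω' : ℝ, H.IsQuasiparticleEnergy k ω ∧
    H.IsQuasiparticleEnergy (-k) ω' ∧ x = |ω + ω'|}

/-- Position-position couplings in the quadrature form
`H = (1/2) ∑ (x H_xx x + x H_xp p + p H_xpᵀ x + p H_pp p) + const`. -/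
def Hxx : Matrix (Site D) (Site D) ℝ := Matrix.of fun j j' => (H.K (j' - j) + H.Δ (j' - j)).re

/-- Momentum-momentum couplings. -/
def Hpp : Matrix (Site D) (Site D) ℝ := Matrix.of fun j j' => (H.K (j' - j) - H.Δ (j' - j)).re

/-- Position-momentum couplings. -/
def Hxp : Matrix (Site D) (Site D) ℝ := Matrix.of fun j j' => (H.Δ (j' - j) - H.K (j' - j)).im

/-- The symbol `∑_r M_{0,r} e^{i k·r}` of a real symmetric translationally invariant matrix of
range `R`. -/
def symbol (R : ℕ) (M : Matrix (Site D) (Site D) ℝ) (k : Momentum D) : ℝ :=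
  ∑ r ∈ box D R, M 0 r * Real.cos (dotK k r)

/-- The operator norm on `ℓ²(ℤ^D)` of such a matrix; as the matrix acts in momentum space as
multiplication by its symbol, this is the supremum of the modulus of the symbol. -/
def opNorm (R : ℕ) (M : Matrix (Site D) (Site D) ℝ) : ℝ := ⨆ k, |symbol R M k|

/-- The symbol of `H_xx`. -/
def X (k : Momentum D) : ℝ := symbol R H.Hxx k

/-- The symbol of `H_pp`. -/
def P (k : Momentum D) : ℝ := symbol R H.Hpp k

/-- `‖H_xx‖`. -/
def normHxx : ℝ := opNorm R H.Hxx

/-- `‖H_pp‖`. -/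
def normHpp : ℝ := opNorm R H.Hpp

/-- A Bogoliubov transformation diagonalizing `H`: the columns of `L(k)` are the eigenvectors of
`g(k)` with energies `ω(k)` and `-ω(-k)`, and the quasiparticle modes
`(β(k), β(-k)†)ᵀ = L(k)⁻¹ (b(k), b(-k)†)ᵀ` obey the canonical commutation relations. Such a
transformation determines the quasiparticle vacuum, by `β(k) |0~⟩ = 0` for all `k`. -/
structure Bogoliubov where
  L : Momentum D → Matrix (Fin 2) (Fin 2) ℂ
  ω : Momentum D → ℝ
  conj_L : ∀ k, (L k).map (starRingEnd ℂ) = τ₁ * L (-k) * τ₁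
  pseudoUnitary : ∀ k, (L k)ᴴ * τ₃ * L k = τ₃
  diagonalizes : ∀ k, H.g k * L k = L k * Matrix.diagonal ![(ω k : ℂ), -(ω (-k) : ℂ)]

end QBH

/-- The real-space block `(2π)^{-D} ∫_BZ e^{i k·(j-j')} f(k) dk` of a covariance matrix (the real
part is the value itself, since correlations of quadratures are real). -/
def fourierBlock {D : ℕ} (f : Momentum D → ℂ) : Matrix (Site D) (Site D) ℝ :=
  Matrix.of fun j j' => Complex.re ((((2 * Real.pi : ℝ) : ℂ) ^ D)⁻¹ *
    ∫ k in BZ D, Complex.exp (Complex.I * dotK k (j - j')) * f k)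

/-- Real-space covariance matrix, in the order `(x, p)`, of a translationally invariant state
with momentum-space covariance matrix `G(k)`. -/
def realSpaceCov {D : ℕ} (G : Momentum D → Matrix (Fin 2) (Fin 2) ℂ) :
    Matrix (Site D ⊕ Site D) (Site D ⊕ Site D) ℝ :=
  Matrix.fromBlocks
    (fourierBlock fun k => G k 0 0) (fourierBlock fun k => G k 0 1)
    (fourierBlock fun k => G k 1 0) (fourierBlock fun k => G k 1 1)

/-- The covariance matrix `Γ = ⟨{R_j, R_j'}⟩` of the quasiparticle vacuum, a zero-mean Gaussian
state: `C(k) = L(k) L(k)†` in the bosonic basis, hence `U† L(k) L(k)† U` for quadratures. -/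
def QBH.Bogoliubov.Γ {D R : ℕ} {H : QBH D R} (Q : H.Bogoliubov) :
    Matrix (Site D ⊕ Site D) (Site D ⊕ Site D) ℝ :=
  realSpaceCov fun k => quadUᴴ * Q.L k * (Q.L k)ᴴ * quadU

/-- The covariance matrix `V^{-1/2} ⊕ V^{1/2}` of the ground state of the harmonic lattice
`V ⊕ 1`, where `V` is the translationally invariant matrix with symbol `V(k)`. -/
def harmonicΓ {D : ℕ} (V : Momentum D → ℝ) :
    Matrix (Site D ⊕ Site D) (Site D ⊕ Site D) ℝ :=
  realSpaceCov fun k => !![((V k ^ (-(1 / 2) : ℝ) : ℝ) : ℂ), 0; 0, ((V k ^ (1 / 2 : ℝ) : ℝ) : ℂ)]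

/-- The symplectic form on the modes of a finite region. -/
def symplecticForm (m : Type*) [DecidableEq m] : Matrix (m ⊕ m) (m ⊕ m) ℝ :=
  Matrix.fromBlocks 0 1 (-1) 0

/-- Entropy of a bosonic mode with symplectic eigenvalue `ν`. -/
def modeEntropy (ν : ℝ) : ℝ :=
  (ν + 1) / 2 * Real.log ((ν + 1) / 2) - (ν - 1) / 2 * Real.log ((ν - 1) / 2)

/-- Symplectic eigenvalues of a covariance matrix of finitely many modes: the positive eigenvalues
of `i Σ Γ`, with multiplicity. -/
def symplecticEigenvalues {m : Type*} [Fintype m] [DecidableEq m]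
    (Γ : Matrix (m ⊕ m) (m ⊕ m) ℝ) : Multiset ℝ :=
  ((Complex.I • (symplecticForm m * Γ).map Complex.ofReal).charpoly.roots.map
    Complex.re).filter fun ν => 0 < ν

/-- Covariance matrix of the reduced state of a region `B`. -/
def restrict {D : ℕ} (Γ : Matrix (Site D ⊕ Site D) (Site D ⊕ Site D) ℝ) (B : Finset (Site D)) :
    Matrix (B ⊕ B) (B ⊕ B) ℝ :=
  Γ.submatrix (Sum.map Subtype.val Subtype.val) (Sum.map Subtype.val Subtype.val)

/-- The entanglement entropy of the finite region `B` (with its complement) in the pure Gaussian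
state with covariance matrix `Γ`: the von Neumann entropy `∑ S(ν_i)` of the reduced state. -/
def entanglementEntropy {D : ℕ} (Γ : Matrix (Site D ⊕ Site D) (Site D ⊕ Site D) ℝ)
    (B : Finset (Site D)) : ℝ :=
  ((symplecticEigenvalues (restrict Γ B)).map modeEntropy).sum

/-- The boundary area `s(B)`: the number of nearest-neighbour pairs that `B` and its complement
share. -/
def area {D : ℕ} (B : Finset (Site D)) : ℕ :=
  {q : Site D × Site D | q.1 ∈ B ∧ q.2 ∉ B ∧ len (q.1 - q.2) = 1}.ncard

/-- The polylogarithm `Li_s(z) = ∑_{n ≥ 1} z^n / n^s`, of integer order, for `|z| < 1`. -/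
def polylog (s : ℤ) (z : ℝ) : ℝ := ∑' n : ℕ, z ^ (n + 1) / ((n : ℝ) + 1) ^ s

/-- `ξ` is a correlation length of the quasiparticle vacuum: position and momentum correlations
are bounded by `K_x e^{-|j-j'|/ξ}` and `K_p e^{-|j-j'|/ξ}`, with the prefactors
`K_x = c ‖H_pp‖ / Δ_Krein` and `K_p = c ‖H_xx‖ / Δ_Krein`. -/
def IsCorrelationLength {D R : ℕ} {H : QBH D R} (Q : H.Bogoliubov) (c ξ : ℝ) : Prop :=
  0 < ξ ∧ ∀ j j' : Site D,
    |Q.Γ (Sum.inl j) (Sum.inl j')| ≤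
        c * H.normHpp / H.kreinGap * Real.exp (-(len (j - j') : ℝ) / ξ) ∧
    |Q.Γ (Sum.inr j) (Sum.inr j')| ≤
        c * H.normHxx / H.kreinGap * Real.exp (-(len (j - j') : ℝ) / ξ)

end Krein

end

/-! Since `H_xp + H_xpᵀ = 0` makes every pairing amplitude real, `g(k) = η + [[κ, δ], [-δ, -κ]]`
with `κ, δ` real and even and `η` real and odd, while `X = κ + δ` and `P = κ - δ`. The quasiparticle
energy is `η + μ` with `μ² = κ² - δ² = X P`, so `η` cancels in `ω(k) + ω(-k) = 2μ` and the Krein gap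
`E` satisfies `E² ≤ 4 X P` (`sq_kreinGap_le`). Pseudo-unitarity gives `g = η + μ L L† τ₃`; hence `L
L†` does not depend on the choice of `L`, and in quadratures it is `diag(√(P/X), √(X/P))`
(`Bogoliubov.cov_eq`). Up to a common sign `X` and `P` are positive, and from there on only a
`GappedPair` of trigonometric polynomials matters.

Decay: `√(x/p) = x · (x p)^{-1/2}`, where `x p` has degree `2R` and values in a compact interval of
positive numbers. Truncating the Legendre generating function approximates `s^{-1/2}` there at a
geometric rate (`exists_polynomial_approx_inv_sqrt`). Fourier coefficients beyond the degree of the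
approximant are bounded by its error.

Area law: on `B` the covariance matrix is `A ⊕ C`, and the squared symplectic eigenvalues are the
eigenvalues `1 + t_i` of `C A = 1 + S A`, with `S = C - A⁻¹ ≥ 0` by a Schur complement. A mode has
entropy at most `(3/2) √t_i`. If `A ≤ α`, Peierls' inequality, used twice, gives `∑ √t_i ≤ √α ∑
√S_ii`, and `S_ii ≤ (C A C - C)_ii ≤ α ∑_{j ∉ B} |Γ_{p_i p_j}|²` (`exists_charpoly_mul_eq`,
`coeffMatrix_mul_mul_sub_le`). So the entropy is controlled by the sum of `|Γ_{p_i p_j}|` over `i ∈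
B`, `j ∉ B`. A translation by `r` moves at most `|r| s(B)` sites out of `B`, which turns this sum
into a polylogarithm (`sum_pow_len_le`). -/

noncomputable section

namespace Krein

/-! ### Polynomial approximation of the inverse square root -/

/-- The Taylor coefficients of `(1 - z)^{-1/2}`. -/
def invSqrtCoeff (n : ℕ) : ℝ := (n.centralBinom : ℝ) / 4 ^ n

lemma invSqrtCoeff_nonneg (n : ℕ) : 0 ≤ invSqrtCoeff n := by
  unfold invSqrtCoeff; positivity

lemma invSqrtCoeff_le_one (n : ℕ) : invSqrtCoeff n ≤ 1 := by
  unfold invSqrtCoeff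
  rw [div_le_one (by positivity)]
  exact_mod_cast Nat.centralBinom_le_four_pow n

lemma succ_mul_invSqrtCoeff_succ (n : ℕ) :
    2 * ((n + 1 : ℕ) : ℝ) * invSqrtCoeff (n + 1) = (2 * n + 1) * invSqrtCoeff n := by
  have h : ((n + 1 : ℕ) : ℝ) * ((n + 1).centralBinom : ℝ)
      = 2 * (2 * n + 1) * (n.centralBinom : ℝ) := by
    exact_mod_cast Nat.succ_mul_centralBinom_succ n
  unfold invSqrtCoeff
  rw [pow_succ]
  field_simp
  linear_combination 2 * h

/-- Coefficientwise form of `((1 - z)^{-1/2})² = (1 - z)⁻¹`. By the symmetry of the convolution,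
weighting its terms by `2 p.1` multiplies the sum by its order; with the recurrence for the
coefficients, consecutive sums agree. -/
lemma sum_antidiagonal_invSqrtCoeff (n : ℕ) :
    ∑ p ∈ Finset.HasAntidiagonal.antidiagonal n, invSqrtCoeff p.1 * invSqrtCoeff p.2 = 1 := by
  have symm : ∀ k : ℕ, 2 * ∑ p ∈ Finset.HasAntidiagonal.antidiagonal k,
      (p.1 : ℝ) * (invSqrtCoeff p.1 * invSqrtCoeff p.2) =
        k * ∑ p ∈ Finset.HasAntidiagonal.antidiagonal k, invSqrtCoeff p.1 * invSqrtCoeff p.2 := by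
    intro k
    have hs : ∑ p ∈ Finset.HasAntidiagonal.antidiagonal k, (p.1 : ℝ) * (invSqrtCoeff p.1 * invSqrtCoeff p.2) =
        ∑ p ∈ Finset.HasAntidiagonal.antidiagonal k, (p.2 : ℝ) * (invSqrtCoeff p.1 * invSqrtCoeff p.2) := by
      rw [← Finset.Nat.sum_antidiagonal_swap]
      exact Finset.sum_congr rfl fun p _ => by simp [mul_comm]
    rw [two_mul]
    nth_rewrite 2 [hs]
    rw [← Finset.sum_add_distrib, Finset.mul_sum]
    refine Finset.sum_congr rfl fun p hp => ?_
    rw [← Finset.HasAntidiagonal.mem_antidiagonal.mp hp]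
    push_cast
    ring
  induction n with
  | zero => simp [invSqrtCoeff]
  | succ n ih =>
    have h1 := symm (n + 1)
    rw [Finset.Nat.sum_antidiagonal_succ] at h1
    have h2 : ∑ p ∈ Finset.HasAntidiagonal.antidiagonal n,
        2 * (((p.1 + 1 : ℕ) : ℝ) * (invSqrtCoeff (p.1 + 1) * invSqrtCoeff p.2)) =
        ∑ p ∈ Finset.HasAntidiagonal.antidiagonal n, (2 * ((p.1 : ℝ) * (invSqrtCoeff p.1 * invSqrtCoeff p.2))
          + invSqrtCoeff p.1 * invSqrtCoeff p.2) := by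
      refine Finset.sum_congr rfl fun p _ => ?_
      linear_combination (succ_mul_invSqrtCoeff_succ p.1) * invSqrtCoeff p.2
    rw [Finset.sum_add_distrib, ← Finset.mul_sum, ← Finset.mul_sum, symm n, ih] at h2
    simp only [Nat.cast_zero, zero_mul, zero_add] at h1
    rw [h2] at h1
    have h3 : ((n + 1 : ℕ) : ℝ) ≠ 0 := by positivity
    apply mul_left_cancel₀ h3
    rw [← h1]
    push_cast
    ring

/-- The Legendre polynomial `P_n(cos θ)` as a trigonometric sum. -/
def legendreCos (n : ℕ) (θ : ℝ) : ℝ :=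
  ∑ p ∈ Finset.HasAntidiagonal.antidiagonal n,
    invSqrtCoeff p.1 * invSqrtCoeff p.2 * Real.cos (((p.1 : ℤ) - (p.2 : ℤ) : ℤ) * θ)

/-- The weights are nonnegative and sum to one, so this is a convex combination of cosines. -/
lemma abs_legendreCos_le_one (n : ℕ) (θ : ℝ) : |legendreCos n θ| ≤ 1 := by
  rw [← sum_antidiagonal_invSqrtCoeff n]
  refine (Finset.abs_sum_le_sum_abs _ _).trans (Finset.sum_le_sum fun p _ => ?_)
  have h := mul_nonneg (invSqrtCoeff_nonneg p.1) (invSqrtCoeff_nonneg p.2)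
  rw [abs_mul, abs_of_nonneg h]
  exact mul_le_of_le_one_right h (Real.abs_cos_le_one _)

/-- The generating function of the Legendre polynomials. -/
lemma hasSum_legendreCos {ρ : ℝ} (h0 : 0 ≤ ρ) (h1 : ρ < 1) (θ : ℝ) :
    HasSum (fun n => ρ ^ n * legendreCos n θ)
      (1 / Real.sqrt (1 + ρ ^ 2 - 2 * ρ * Real.cos θ)) := by
  set z : ℂ := ρ * Complex.exp (θ * Complex.I) with hz
  have hnz : ‖z‖ = ρ := by
    rw [hz, norm_mul, Complex.norm_exp_ofReal_mul_I, Complex.norm_real, Real.norm_eq_abs,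
      abs_of_nonneg h0, mul_one]
  let F : ℂ → ℕ → ℂ := fun w n => (invSqrtCoeff n : ℂ) * w ^ n
  have hsF : ∀ w : ℂ, ‖w‖ = ρ → Summable fun n => ‖F w n‖ := by
    intro w hw
    refine Summable.of_nonneg_of_le (fun _ => norm_nonneg _) (fun n => ?_)
      (summable_geometric_of_lt_one h0 h1)
    simp only [F, norm_mul, norm_pow, hw, Complex.norm_real, Real.norm_eq_abs,
      abs_of_nonneg (invSqrtCoeff_nonneg n)]
    exact mul_le_of_le_one_left (by positivity) (invSqrtCoeff_le_one n)
  -- With `f` the sum of the series, `f(z)² = (1 - z)⁻¹` gives `|f(z)|² = 1 / |1 - z|`. The Cauchy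
  -- product of `f(z)` and its conjugate then produces the Legendre terms.
  have hsq : ∀ w : ℂ, ‖w‖ = ρ → (∑' n, F w n) * (∑' n, F w n) = (1 - w)⁻¹ := by
    intro w hw
    rw [tsum_mul_tsum_eq_tsum_sum_antidiagonal_of_summable_norm (hsF w hw) (hsF w hw),
      ← tsum_geometric_of_norm_lt_one (hw ▸ h1)]
    refine tsum_congr fun n => ?_
    have h := congrArg (fun x : ℝ => (x : ℂ)) (sum_antidiagonal_invSqrtCoeff n)
    push_cast at h
    rw [← one_mul (w ^ n), ← h, Finset.sum_mul]
    refine Finset.sum_congr rfl fun p hp => ?_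
    rw [← Finset.HasAntidiagonal.mem_antidiagonal.mp hp, pow_add]
    simp only [F]
    ring
  have hcz : ‖conj z‖ = ρ := by rw [RCLike.norm_conj, hnz]
  have hconj : (∑' n, F (conj z) n) = conj (∑' n, F z n) := by
    rw [Complex.conj_tsum]
    exact tsum_congr fun n => by simp [F]
  have hterm : ∀ n, ∑ p ∈ Finset.HasAntidiagonal.antidiagonal n, F z p.1 * F (conj z) p.2 =
      ∑ p ∈ Finset.HasAntidiagonal.antidiagonal n, ((invSqrtCoeff p.1 * invSqrtCoeff p.2 * ρ ^ n : ℝ) : ℂ) *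
        Complex.exp (((((p.1 : ℤ) - (p.2 : ℤ) : ℤ) * θ : ℝ) : ℂ) * Complex.I) := by
    intro n
    refine Finset.sum_congr rfl fun p hp => ?_
    have hc : conj z = ρ * Complex.exp (-(θ * Complex.I)) := by
      rw [hz, map_mul, ← Complex.exp_conj]
      simp
    rw [← Finset.HasAntidiagonal.mem_antidiagonal.mp hp, hc]
    simp only [F, hz, mul_pow, ← Complex.exp_nat_mul]
    have : Complex.exp (((((p.1 : ℤ) - (p.2 : ℤ) : ℤ) * θ : ℝ) : ℂ) * Complex.I) =
        Complex.exp (p.1 * (θ * Complex.I)) * Complex.exp (p.2 * -(θ * Complex.I)) := by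
      rw [← Complex.exp_add]
      congr 1
      push_cast
      ring
    rw [this, pow_add]
    push_cast
    ring
  have hsum := (summable_norm_sum_mul_antidiagonal_of_summable_norm (hsF z hnz)
    (hsF _ hcz)).of_norm.hasSum
  rw [← tsum_mul_tsum_eq_tsum_sum_antidiagonal_of_summable_norm (hsF z hnz) (hsF _ hcz),
    hconj, Complex.mul_conj] at hsum
  have hre := Complex.hasSum_re hsum
  have hval : Complex.normSq (∑' n, F z n) =
      1 / Real.sqrt (1 + ρ ^ 2 - 2 * ρ * Real.cos θ) := by
    have h := congrArg (fun w : ℂ => ‖w‖) (hsq z hnz)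
    simp only [norm_mul, norm_inv] at h
    rw [Complex.normSq_eq_norm_sq, sq, h, one_div]
    congr 1
    rw [Complex.norm_def]
    congr 1
    have hzre : z.re = ρ * Real.cos θ := by simp [hz, Complex.exp_ofReal_mul_I_re]
    have hzim : z.im = ρ * Real.sin θ := by simp [hz, Complex.exp_ofReal_mul_I_im]
    simp only [Complex.normSq_apply, Complex.sub_re, Complex.sub_im, Complex.one_re,
      Complex.one_im, hzre, hzim]
    linear_combination ρ ^ 2 * Real.sin_sq_add_cos_sq θ
  rw [Complex.ofReal_re, hval] at hre
  convert! hre using 1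
  funext n
  rw [hterm, Complex.re_sum, legendreCos, Finset.mul_sum]
  refine Finset.sum_congr rfl fun p _ => ?_
  rw [Complex.re_ofReal_mul, Complex.exp_ofReal_mul_I_re]
  ring

/-- Approximation of `x^{-1/2}` on `[m, M]` by polynomials of degree less than `n`, at the rate
of the Chebyshev approximation. -/
theorem exists_polynomial_approx_inv_sqrt {m M : ℝ} (hm : 0 < m) (hM : m < M) (n : ℕ) :
    ∃ q ∈ Polynomial.degreeLT ℝ n, ∀ x ∈ Set.Icc m M, |1 / Real.sqrt x - q.eval x| ≤
      ((Real.sqrt M - Real.sqrt m) / (Real.sqrt M + Real.sqrt m)) ^ n / Real.sqrt m := by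
  set u := Real.sqrt m with hu
  set v := Real.sqrt M with hv
  have hu0 : 0 < u := Real.sqrt_pos.mpr hm
  have huv : u < v := Real.sqrt_lt_sqrt hm.le hM
  have hum : u ^ 2 = m := Real.sq_sqrt hm.le
  have hvM : v ^ 2 = M := Real.sq_sqrt (hm.trans hM).le
  -- `ρ` and `a` are chosen so that `a² (1 + ρ² - 2ρt)` runs over `[m, M]` as `t` runs over `[-1,
  -- 1]`; `lin` below recovers `t` from `x`.
  set ρ := (v - u) / (v + u) with hρ
  have hρ0 : 0 < ρ := div_pos (by linarith) (by linarith)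
  have hρ1 : ρ < 1 := by rw [hρ, div_lt_one (by linarith)]; linarith
  set a := (v + u) / 2 with ha
  have ha0 : 0 < a := by rw [ha]; linarith
  have hne : v + u ≠ 0 := by linarith
  have hau : a * (1 - ρ) = u := by
    rw [ha, hρ]; field_simp [hne]; ring
  have hav : a * (1 + ρ) = v := by
    rw [ha, hρ]; field_simp [hne]; ring
  let lin : Polynomial ℝ := Polynomial.C ((1 + ρ ^ 2) / (2 * ρ)) -
    Polynomial.C (1 / (2 * ρ * a ^ 2)) * Polynomial.X
  have hlin : lin.natDegree ≤ 1 := by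
    refine (Polynomial.natDegree_sub_le _ _).trans ?_
    rw [Polynomial.natDegree_C]
    exact max_le (by norm_num)
      ((Polynomial.natDegree_C_mul_le _ _).trans Polynomial.natDegree_X_le)
  let q : Polynomial ℝ := ∑ j ∈ Finset.range n, ∑ p ∈ Finset.HasAntidiagonal.antidiagonal j,
    Polynomial.C (1 / a * ρ ^ j * (invSqrtCoeff p.1 * invSqrtCoeff p.2)) *
      (Polynomial.Chebyshev.T ℝ ((p.1 : ℤ) - (p.2 : ℤ))).comp lin
  refine ⟨q, ?_, ?_⟩
  · refine Submodule.sum_mem _ fun j hj => Submodule.sum_mem _ fun p hp => ?_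
    rw [Polynomial.C_mul']
    refine Submodule.smul_mem _ _ (Polynomial.mem_degreeLT.mpr ?_)
    refine lt_of_le_of_lt Polynomial.degree_le_natDegree ?_
    have hj' := Finset.mem_range.mp hj
    have hp' := Finset.HasAntidiagonal.mem_antidiagonal.mp hp
    have h1 : ((Polynomial.Chebyshev.T ℝ ((p.1 : ℤ) - (p.2 : ℤ))).comp lin).natDegree ≤ j := by
      rw [Polynomial.natDegree_comp, Polynomial.Chebyshev.natDegree_T]
      calc ((p.1 : ℤ) - (p.2 : ℤ)).natAbs * lin.natDegree
          ≤ ((p.1 : ℤ) - (p.2 : ℤ)).natAbs * 1 := Nat.mul_le_mul_left _ hlin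
        _ ≤ j := by omega
    exact_mod_cast lt_of_le_of_lt h1 hj'
  · intro x hx
    set t := (1 + ρ ^ 2) / (2 * ρ) - 1 / (2 * ρ * a ^ 2) * x with ht
    have hxt : x = a ^ 2 * (1 + ρ ^ 2 - 2 * ρ * t) := by
      rw [ht]; field_simp; ring
    have ht1 : t ≤ 1 := by
      have h2 : a ^ 2 * (2 * ρ) * t ≤ a ^ 2 * (2 * ρ) * 1 := by
        have := hx.1
        rw [← hum, ← hau] at this
        nlinarith
      exact le_of_mul_le_mul_left h2 (by positivity)
    have ht2 : -1 ≤ t := by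
      have h2 : a ^ 2 * (2 * ρ) * (-1) ≤ a ^ 2 * (2 * ρ) * t := by
        have := hx.2
        rw [← hvM, ← hav] at this
        nlinarith
      exact le_of_mul_le_mul_left h2 (by positivity)
    have hcos : Real.cos (Real.arccos t) = t := Real.cos_arccos ht2 ht1
    set θ := Real.arccos t with hθ
    have hq : q.eval x = 1 / a * ∑ j ∈ Finset.range n, ρ ^ j * legendreCos j θ := by
      simp only [q, Polynomial.eval_finsetSum, Polynomial.eval_mul, Polynomial.eval_C,
        Polynomial.eval_comp, legendreCos, Finset.mul_sum]
      refine Finset.sum_congr rfl fun j _ => Finset.sum_congr rfl fun p _ => ?_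
      have hl : lin.eval x = Real.cos θ := by
        rw [hcos, ht]; simp [lin]
      rw [hl, Polynomial.Chebyshev.T_real_cos]
      ring
    have hs : 1 / Real.sqrt x = 1 / a * (1 / Real.sqrt (1 + ρ ^ 2 - 2 * ρ * Real.cos θ)) := by
      rw [hcos, hxt, Real.sqrt_mul (by positivity), Real.sqrt_sq ha0.le]
      rw [one_div_mul_one_div]
    rw [hq, hs, ← mul_sub, abs_mul, abs_of_pos (by positivity : 0 < 1 / a), abs_sub_comm]
    -- The tail is at most `ρⁿ / (1 - ρ)`, and `a (1 - ρ) = √m` gives the stated constant.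
    have hb := norm_sub_le_of_geometric_bound_of_hasSum (C := 1) hρ1
      (f := fun n => ρ ^ n * legendreCos n θ) (fun k => by
        rw [Real.norm_eq_abs, abs_mul, abs_of_pos (by positivity : 0 < ρ ^ k), one_mul]
        exact mul_le_of_le_one_right (by positivity) (abs_legendreCos_le_one k θ))
      (hasSum_legendreCos hρ0.le hρ1 θ) n
    rw [Real.norm_eq_abs, one_mul] at hb
    calc _ ≤ 1 / a * (ρ ^ n / (1 - ρ)) := by gcongr
      _ = ρ ^ n / u := by
        rw [← hau, one_div, div_eq_mul_inv, div_eq_mul_inv, mul_inv]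
        ring

/-! ### Averages over the Brillouin zone and lattice Fourier coefficients -/

section Lattice

variable {D : ℕ}

@[simp] lemma len_neg (r : Site D) : len (-r) = len r := by simp [len]

@[simp] lemma len_zero : len (0 : Site D) = 0 := by simp [len]

lemma len_add_le (r s : Site D) : len (r + s) ≤ len r + len s := by
  unfold len
  rw [← Finset.sum_add_distrib]
  exact Finset.sum_le_sum fun μ _ => Int.natAbs_add_le _ _

lemma len_sub_le (r s : Site D) : len (r - s) ≤ len r + len s := by
  rw [sub_eq_add_neg, ← len_neg s]
  exact len_add_le _ _

lemma len_sub_comm (r s : Site D) : len (r - s) = len (s - r) := by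
  rw [← len_neg, neg_sub]

lemma natAbs_le_len (r : Site D) (μ : Fin D) : (r μ).natAbs ≤ len r :=
  Finset.single_le_sum (f := fun μ => (r μ).natAbs) (fun _ _ => Nat.zero_le _) (Finset.mem_univ μ)

lemma len_eq_zero {r : Site D} : len r = 0 ↔ r = 0 := by
  constructor
  · intro h
    funext μ
    have := natAbs_le_len r μ
    simp only [Pi.zero_apply]
    omega
  · rintro rfl
    exact len_zero

lemma mem_box_of_len_le {r : Site D} {N : ℕ} (h : len r ≤ N) : r ∈ box D N := by
  rw [box, Finset.mem_Icc]
  constructor <;> intro μ <;> have := natAbs_le_len r μ <;> dsimp only <;> omega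

lemma neg_mem_box {r : Site D} {N : ℕ} (h : r ∈ box D N) : -r ∈ box D N := by
  rw [box, Finset.mem_Icc] at *
  exact ⟨fun μ => by have := h.2 μ; simp only [Pi.neg_apply] at *; lia,
    fun μ => by have := h.1 μ; simp only [Pi.neg_apply] at *; lia⟩

/-- The sites of path length at most `N`. -/
def lenBall (D N : ℕ) : Finset (Site D) := (box D N).filter fun r => len r ≤ N

@[simp] lemma mem_lenBall {N : ℕ} {r : Site D} : r ∈ lenBall D N ↔ len r ≤ N := by
  simp only [lenBall, Finset.mem_filter, and_iff_right_iff_imp]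
  exact mem_box_of_len_le

lemma dotK_add (k : Momentum D) (r s : Site D) : dotK k (r + s) = dotK k r + dotK k s := by
  simp [dotK, mul_add, Finset.sum_add_distrib]

lemma dotK_neg (k : Momentum D) (r : Site D) : dotK k (-r) = -dotK k r := by
  simp [dotK]

lemma dotK_sub (k : Momentum D) (r s : Site D) : dotK k (r - s) = dotK k r - dotK k s := by
  rw [sub_eq_add_neg, dotK_add, dotK_neg, sub_eq_add_neg]

lemma neg_dotK (k : Momentum D) (r : Site D) : dotK (-k) r = -dotK k r := by
  simp [dotK]

@[simp] lemma dotK_zero (k : Momentum D) : dotK k 0 = 0 := by simp [dotK]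

@[fun_prop] lemma continuous_dotK (r : Site D) : Continuous fun k => dotK k r := by
  unfold dotK; fun_prop

lemma volume_BZ : (MeasureTheory.volume (BZ D)).toReal = (2 * Real.pi) ^ D := by
  have h : (fun _ : Fin D => -Real.pi) ≤ fun _ => Real.pi := fun _ => by
    have := Real.pi_pos
    dsimp only
    linarith
  rw [BZ, Real.volume_Icc_pi_toReal h]
  simp only [Finset.prod_const, Finset.card_univ, Fintype.card_fin]
  ring

lemma isCompact_BZ : IsCompact (BZ D) := isCompact_Icc

/-- The average of a function over the Brillouin zone. -/
def mean (f : Momentum D → ℝ) : ℝ := ((2 * Real.pi) ^ D)⁻¹ * ∫ k in BZ D, f k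

lemma integrableOn_BZ {E : Type*} [NormedAddCommGroup E] {f : Momentum D → E}
    (hf : Continuous f) : MeasureTheory.IntegrableOn f (BZ D) :=
  hf.continuousOn.integrableOn_compact isCompact_BZ

lemma mean_add {f g : Momentum D → ℝ} (hf : Continuous f) (hg : Continuous g) :
    mean (fun k => f k + g k) = mean f + mean g := by
  unfold mean
  rw [MeasureTheory.integral_add (integrableOn_BZ hf) (integrableOn_BZ hg), mul_add]

lemma mean_const_mul (c : ℝ) (f : Momentum D → ℝ) :
    mean (fun k => c * f k) = c * mean f := by
  unfold mean
  rw [MeasureTheory.integral_const_mul]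
  ring

lemma mean_sub {f g : Momentum D → ℝ} (hf : Continuous f) (hg : Continuous g) :
    mean (fun k => f k - g k) = mean f - mean g := by
  unfold mean
  rw [MeasureTheory.integral_sub (integrableOn_BZ hf) (integrableOn_BZ hg), mul_sub]

lemma mean_sum {ι : Type*} (s : Finset ι) {f : ι → Momentum D → ℝ}
    (hf : ∀ i ∈ s, Continuous (f i)) :
    mean (fun k => ∑ i ∈ s, f i k) = ∑ i ∈ s, mean (f i) := by
  unfold mean
  rw [MeasureTheory.integral_finsetSum s fun i hi => integrableOn_BZ (hf i hi), Finset.mul_sum]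

lemma mean_mono {f g : Momentum D → ℝ} (hf : Continuous f) (hg : Continuous g)
    (h : ∀ k, f k ≤ g k) : mean f ≤ mean g := by
  unfold mean
  have := MeasureTheory.integral_mono (integrableOn_BZ hf) (integrableOn_BZ hg) h
  gcongr

lemma mean_const (c : ℝ) : mean (fun _ : Momentum D => c) = c := by
  unfold mean
  rw [MeasureTheory.setIntegral_const, MeasureTheory.Measure.real, volume_BZ, smul_eq_mul]
  have : (2 * Real.pi) ^ D ≠ 0 := by positivity
  field_simp

lemma mean_nonneg {f : Momentum D → ℝ} (h : ∀ k, 0 ≤ f k) : 0 ≤ mean f := by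
  unfold mean
  have := MeasureTheory.integral_nonneg (μ := MeasureTheory.volume.restrict (BZ D))
    (f := f) fun k => h k
  positivity

lemma abs_mean_le {f : Momentum D → ℝ} (hf : Continuous f) {c : ℝ} (h : ∀ k, |f k| ≤ c) :
    |mean f| ≤ c := by
  rw [abs_le]
  constructor
  · rw [← mean_const (D := D) (-c)]
    exact mean_mono continuous_const hf fun k => (abs_le.mp (h k)).1
  · rw [← mean_const (D := D) c]
    exact mean_mono hf continuous_const fun k => (abs_le.mp (h k)).2

lemma integral_exp_dotK_eq_zero {r : Site D} (hr : r ≠ 0) :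
    ∫ k in BZ D, Complex.exp (Complex.I * dotK k r) = 0 := by
  have h1 : ∀ k : Momentum D, Complex.exp (Complex.I * dotK k r) =
      ∏ μ, Complex.exp (Complex.I * (r μ : ℂ) * (k μ : ℂ)) := by
    intro k
    rw [← Complex.exp_sum, dotK]
    congr 1
    push_cast
    rw [Finset.mul_sum]
    exact Finset.sum_congr rfl fun μ _ => by ring
  obtain ⟨μ, hμ⟩ := Function.ne_iff.mp hr
  simp_rw [h1]
  rw [BZ, ← Set.pi_univ_Icc, MeasureTheory.volume_pi, MeasureTheory.Measure.restrict_pi_pi,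
    MeasureTheory.integral_fintype_prod_eq_prod
      (f := fun μ (x : ℝ) => Complex.exp (Complex.I * (r μ : ℂ) * (x : ℂ)))]
  refine Finset.prod_eq_zero (Finset.mem_univ μ) ?_
  have hπ : -Real.pi ≤ Real.pi := by linarith [Real.pi_pos]
  have hne : Complex.I * (r μ : ℂ) ≠ 0 := mul_ne_zero Complex.I_ne_zero (by exact_mod_cast hμ)
  rw [MeasureTheory.integral_Icc_eq_integral_Ioc, ← intervalIntegral.integral_of_le hπ,
    integral_exp_mul_complex hne]
  have h2 : Complex.exp (Complex.I * (r μ : ℂ) * ((Real.pi : ℝ) : ℂ)) =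
      Complex.exp (Complex.I * (r μ : ℂ) * ((-Real.pi : ℝ) : ℂ)) := by
    rw [Complex.exp_eq_exp_iff_exists_int]
    refine ⟨r μ, ?_⟩
    push_cast
    ring
  rw [h2, sub_self, zero_div]

lemma mean_cos (r : Site D) :
    mean (fun k => Real.cos (dotK k r)) = if r = 0 then 1 else 0 := by
  split_ifs with h
  · subst h
    simp [mean_const]
  · unfold mean
    have h1 : ∀ k : Momentum D, Real.cos (dotK k r) =
        RCLike.re (Complex.exp (Complex.I * dotK k r)) := by
      intro k
      rw [mul_comm]
      exact (Complex.exp_ofReal_mul_I_re _).symm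
    simp_rw [h1]
    have h2 := integral_re (𝕜 := ℂ) (μ := MeasureTheory.volume.restrict (BZ D))
      (f := fun k : Momentum D => Complex.exp (Complex.I * dotK k r))
      (integrableOn_BZ (by fun_prop))
    rw [h2, integral_exp_dotK_eq_zero h]
    simp

/-- The Fourier coefficient of an even real function. -/
def coeff (f : Momentum D → ℝ) (r : Site D) : ℝ := mean fun k => Real.cos (dotK k r) * f k

@[simp] lemma coeff_neg_site (f : Momentum D → ℝ) (r : Site D) : coeff f (-r) = coeff f r := by
  simp [coeff, dotK_neg]

lemma coeff_sub_comm (f : Momentum D → ℝ) (r s : Site D) :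
    coeff f (r - s) = coeff f (s - r) := by
  rw [← coeff_neg_site, neg_sub]

lemma coeff_sub {f g : Momentum D → ℝ} (hf : Continuous f) (hg : Continuous g) (r : Site D) :
    coeff (fun k => f k - g k) r = coeff f r - coeff g r := by
  unfold coeff
  rw [← mean_sub (by fun_prop) (by fun_prop)]
  simp only [mul_sub]

lemma abs_coeff_le {f : Momentum D → ℝ} (hf : Continuous f) {c : ℝ} (h : ∀ k, |f k| ≤ c)
    (r : Site D) : |coeff f r| ≤ c := by
  refine abs_mean_le (by fun_prop) fun k => ?_
  rw [abs_mul]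
  exact (mul_le_of_le_one_left (abs_nonneg _) (Real.abs_cos_le_one _)).trans (h k)

lemma fourierBlock_ofReal {f : Momentum D → ℝ} (hf : Continuous f) (j j' : Site D) :
    fourierBlock (fun k => (f k : ℂ)) j j' = coeff f (j - j') := by
  rw [fourierBlock, Matrix.of_apply, coeff, mean]
  have h1 : ((((2 * Real.pi : ℝ) : ℂ) ^ D)⁻¹) = ((((2 * Real.pi) ^ D)⁻¹ : ℝ) : ℂ) := by
    push_cast; rfl
  rw [h1, Complex.re_ofReal_mul]
  congr 1
  have h2 := integral_re (𝕜 := ℂ) (μ := MeasureTheory.volume.restrict (BZ D))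
    (f := fun k : Momentum D => Complex.exp (Complex.I * dotK k (j - j')) * (f k : ℂ))
    (integrableOn_BZ (by fun_prop))
  refine Eq.trans h2.symm ?_
  congr 1
  funext k
  rw [mul_comm Complex.I]
  change Complex.re _ = _
  rw [Complex.re_mul_ofReal, Complex.exp_ofReal_mul_I_re]

/-! ### Trigonometric polynomials -/

/-- Even real trigonometric polynomials of degree at most `N`. -/
def trigPoly (D N : ℕ) : Submodule ℝ (Momentum D → ℝ) :=
  Submodule.span ℝ {f | ∃ r : Site D, len r ≤ N ∧ f = fun k => Real.cos (dotK k r)}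

lemma cos_mem_trigPoly {r : Site D} {N : ℕ} (h : len r ≤ N) :
    (fun k => Real.cos (dotK k r)) ∈ trigPoly D N :=
  Submodule.subset_span ⟨r, h, rfl⟩

lemma trigPoly_mono {M N : ℕ} (h : M ≤ N) : trigPoly D M ≤ trigPoly D N :=
  Submodule.span_mono fun _ ⟨r, hr, hf⟩ => ⟨r, hr.trans h, hf⟩

lemma one_mem_trigPoly (N : ℕ) : (1 : Momentum D → ℝ) ∈ trigPoly D N := by
  convert cos_mem_trigPoly (D := D) (r := 0) (N := N) (by simp)
  simp

lemma continuous_of_mem_trigPoly {N : ℕ} {f : Momentum D → ℝ} (hf : f ∈ trigPoly D N) :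
    Continuous f := by
  induction hf using Submodule.span_induction with
  | mem f h => obtain ⟨r, -, rfl⟩ := h; fun_prop
  | zero => exact continuous_const
  | add f g _ _ hf hg => exact hf.add hg
  | smul c f _ hf => exact continuous_const.mul hf

/-- Product-to-sum formula together with the triangle inequality for `len`. -/
lemma mul_mem_trigPoly {M N : ℕ} {f g : Momentum D → ℝ} (hf : f ∈ trigPoly D M)
    (hg : g ∈ trigPoly D N) : f * g ∈ trigPoly D (M + N) := by
  induction hf using Submodule.span_induction with
  | mem f h =>
    obtain ⟨r, hr, rfl⟩ := h
    induction hg using Submodule.span_induction with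
    | mem g h =>
      obtain ⟨s, hs, rfl⟩ := h
      have : (fun k : Momentum D => Real.cos (dotK k r)) * (fun k => Real.cos (dotK k s)) =
          (1 / 2 : ℝ) • ((fun k => Real.cos (dotK k (r + s))) +
            fun k => Real.cos (dotK k (r - s))) := by
        funext k
        simp only [Pi.mul_apply, Pi.smul_apply, Pi.add_apply, dotK_add, dotK_sub, Real.cos_add,
          Real.cos_sub, smul_eq_mul]
        ring
      rw [this]
      exact Submodule.smul_mem _ _ (Submodule.add_mem _
        (cos_mem_trigPoly ((len_add_le r s).trans (add_le_add hr hs)))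
        (cos_mem_trigPoly ((len_sub_le r s).trans (add_le_add hr hs))))
    | zero => rw [mul_zero]; exact Submodule.zero_mem _
    | add f g _ _ hf hg => rw [mul_add]; exact Submodule.add_mem _ hf hg
    | smul c f _ hf => rw [mul_smul_comm]; exact Submodule.smul_mem _ _ hf
  | zero => rw [zero_mul]; exact Submodule.zero_mem _
  | add f g _ _ hf hg => rw [add_mul]; exact Submodule.add_mem _ hf hg
  | smul c f _ hf => rw [smul_mul_assoc]; exact Submodule.smul_mem _ _ hf

lemma pow_mem_trigPoly {N : ℕ} {f : Momentum D → ℝ} (hf : f ∈ trigPoly D N) (n : ℕ) :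
    f ^ n ∈ trigPoly D (n * N) := by
  induction n with
  | zero => rw [pow_zero]; exact one_mem_trigPoly _
  | succ n ih => rw [pow_succ, Nat.succ_mul]; exact mul_mem_trigPoly ih hf

/-- The truncated `n - 1` is harmless at `n = 0`, where `q = 0`. -/
lemma mul_eval_mem_trigPoly {M N n : ℕ} {f g : Momentum D → ℝ} (hg : g ∈ trigPoly D M)
    (hf : f ∈ trigPoly D N) {q : Polynomial ℝ} (hq : q ∈ Polynomial.degreeLT ℝ n) :
    (fun k => g k * q.eval (f k)) ∈ trigPoly D (M + (n - 1) * N) := by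
  rw [Polynomial.degreeLT_eq_span_X_pow] at hq
  induction hq using Submodule.span_induction with
  | mem q h =>
    rw [Finset.mem_coe, Finset.mem_image] at h
    obtain ⟨i, hi, rfl⟩ := h
    have hi' := Finset.mem_range.mp hi
    have : (fun k => g k * (Polynomial.X ^ i : Polynomial ℝ).eval (f k)) = g * f ^ i := by
      funext k; simp
    rw [this]
    exact trigPoly_mono (by gcongr; omega) (mul_mem_trigPoly hg (pow_mem_trigPoly hf i))
  | zero => simp only [Polynomial.eval_zero, mul_zero]; exact Submodule.zero_mem _
  | add p q _ _ hp hq =>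
    simp only [Polynomial.eval_add, mul_add]
    exact Submodule.add_mem _ hp hq
  | smul c p _ hp =>
    have : (fun k => g k * (c • p).eval (f k)) = c • fun k => g k * p.eval (f k) := by
      funext k; simp only [Polynomial.eval_smul, smul_eq_mul, Pi.smul_apply]; ring
    rw [this]
    exact Submodule.smul_mem _ _ hp

/-- A cosine carries half its weight at `r` and half at `-r`; for `r = 0` the two indicators add up
to one. -/
lemma coeff_cos (r s : Site D) : coeff (fun k => Real.cos (dotK k r)) s =
    1 / 2 * ((if r = s then 1 else 0) + if r = -s then 1 else 0) := by
  have : ∀ k : Momentum D, Real.cos (dotK k s) * Real.cos (dotK k r) =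
      1 / 2 * (Real.cos (dotK k (r - s)) + Real.cos (dotK k (r + s))) := by
    intro k
    rw [dotK_add, dotK_sub, Real.cos_add, Real.cos_sub]
    ring
  simp only [coeff, this]
  rw [mean_const_mul, mean_add (by fun_prop) (by fun_prop), mean_cos, mean_cos]
  simp only [sub_eq_zero, add_eq_zero_iff_eq_neg]

lemma coeff_eq_zero_of_mem_trigPoly {N : ℕ} {f : Momentum D → ℝ} (hf : f ∈ trigPoly D N)
    {s : Site D} (hs : N < len s) : coeff f s = 0 := by
  have key : ∀ g ∈ trigPoly D N, coeff g s = 0 := by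
    intro g hg
    induction hg using Submodule.span_induction with
    | mem f h =>
      obtain ⟨r, hr, rfl⟩ := h
      rw [coeff_cos, if_neg, if_neg]
      · simp
      · rintro rfl
        simp at hr
        omega
      · rintro rfl
        omega
    | zero => simp [coeff, mean_const]
    | add f g hf hg h1 h2 =>
      have hf := continuous_of_mem_trigPoly hf
      have hg := continuous_of_mem_trigPoly hg
      simp only [coeff, Pi.add_apply, mul_add] at *
      rw [mean_add (by fun_prop) (by fun_prop), h1, h2, add_zero]
    | smul c f _ hf =>
      simp only [coeff, Pi.smul_apply, smul_eq_mul, mul_left_comm _ c] at *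
      rw [mean_const_mul, hf, mul_zero]
  exact key f hf

/-- The square mean of a continuous function is bounded by its Fourier coefficients in a ball and
the distance to any trigonometric polynomial. -/
lemma mean_sq_le {v : Momentum D → ℝ} (hv : Continuous v) {N : ℕ} {f : Momentum D → ℝ}
    (hf : f ∈ trigPoly D N) :
    mean (fun k => v k ^ 2) ≤
      ∑ r ∈ lenBall D N, coeff v r ^ 2 + mean (fun k => (v k - f k) ^ 2) := by
  -- `p` is the orthogonal projection of `v` onto `trigPoly D N`. Pythagoras is used for `v = p + (v
  -- - p)` (`h2`) and for `v - f = (v - p) + (p - f)` (`h3`).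
  set p : Momentum D → ℝ := fun k => ∑ r ∈ lenBall D N, coeff v r * Real.cos (dotK k r) with hp
  have hpc : Continuous p := by rw [hp]; fun_prop
  have hpm : p ∈ trigPoly D N := by
    have : p = ∑ r ∈ lenBall D N, coeff v r • fun k => Real.cos (dotK k r) := by
      funext k
      simp [hp, Finset.sum_apply]
    rw [this]
    exact Submodule.sum_mem _ fun r hr =>
      Submodule.smul_mem _ _ (cos_mem_trigPoly (mem_lenBall.mp hr))
  have horth : ∀ g ∈ trigPoly D N, mean (fun k => g k * (v k - p k)) = 0 := by
    intro g hg
    induction hg using Submodule.span_induction with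
    | mem g h =>
      obtain ⟨s, hs, rfl⟩ := h
      change coeff (fun k => v k - p k) s = 0
      rw [coeff_sub hv hpc, sub_eq_zero]
      have h1 : coeff p s = ∑ r ∈ lenBall D N, coeff v r *
          coeff (fun k => Real.cos (dotK k r)) s := by
        simp only [coeff, hp, Finset.mul_sum]
        rw [mean_sum _ fun r _ => by fun_prop]
        refine Finset.sum_congr rfl fun r _ => ?_
        rw [← mean_const_mul]
        congr 1
        funext k
        ring
      have h2 : -s ∈ lenBall D N := by simpa using hs
      rw [h1]
      simp only [coeff_cos, mul_add, mul_ite, mul_one, mul_zero, Finset.sum_add_distrib,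
        Finset.sum_ite_eq', mem_lenBall, hs, if_true, len_neg, coeff_neg_site]
      ring
    | zero => simp [mean_const]
    | add f g hf hg h1 h2 =>
      have hf := continuous_of_mem_trigPoly hf
      have hg := continuous_of_mem_trigPoly hg
      simp only [Pi.add_apply, add_mul]
      rw [mean_add (by fun_prop) (by fun_prop), h1, h2, add_zero]
    | smul c f _ hf =>
      simp only [Pi.smul_apply, smul_eq_mul, mul_assoc]
      rw [mean_const_mul, hf, mul_zero]
  have hfc := continuous_of_mem_trigPoly hf
  have h1 : mean (fun k => p k * v k) = ∑ r ∈ lenBall D N, coeff v r ^ 2 := by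
    simp only [hp, Finset.sum_mul]
    rw [mean_sum _ fun r _ => by fun_prop]
    refine Finset.sum_congr rfl fun r _ => ?_
    simp only [mul_assoc]
    rw [mean_const_mul, sq]
    rfl
  have h2 : mean (fun k => v k ^ 2) = mean (fun k => (v k - p k) ^ 2) +
      mean (fun k => p k * (v k - p k)) + mean (fun k => p k * v k) := by
    rw [← mean_add (by fun_prop) (by fun_prop), ← mean_add (by fun_prop) (by fun_prop)]
    congr 1
    funext k
    ring
  have h3 : mean (fun k => (v k - f k) ^ 2) = mean (fun k => (v k - p k) ^ 2) +
      2 * mean (fun k => (p - f) k * (v k - p k)) + mean (fun k => (p k - f k) ^ 2) := by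
    rw [← mean_const_mul, ← mean_add (by fun_prop) (by simp only [Pi.sub_apply]; fun_prop),
      ← mean_add (by simp only [Pi.sub_apply]; fun_prop) (by fun_prop)]
    congr 1
    funext k
    simp only [Pi.sub_apply]
    ring
  have h4 : 0 ≤ mean (fun k => (p k - f k) ^ 2) := mean_nonneg fun k => sq_nonneg _
  rw [horth _ (Submodule.sub_mem _ hpm hf)] at h3
  rw [horth _ hpm, h1] at h2
  linarith

end Lattice

/-! ### Bloch dynamical matrices with vanishing symmetric position-momentum coupling -/

lemma sum_box_odd {D R : ℕ} {f : Site D → ℝ} (hf : ∀ r, f (-r) = -f r) :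
    ∑ r ∈ box D R, f r = 0 := by
  have h : ∑ r ∈ box D R, f r = ∑ r ∈ box D R, f (-r) :=
    Finset.sum_nbij' (fun r => -r) (fun r => -r) (fun _ h => neg_mem_box h)
      (fun _ h => neg_mem_box h) (fun _ _ => neg_neg _) (fun _ _ => neg_neg _)
      (fun _ _ => by rw [neg_neg])
  simp only [hf, Finset.sum_neg_distrib] at h
  linarith

/-- Every quasi-momentum is equivalent to one in the first Brillouin zone. -/
lemma exists_mem_BZ {D : ℕ} (k : Momentum D) :
    ∃ k' ∈ BZ D, ∀ r : Site D, Real.cos (dotK k' r) = Real.cos (dotK k r) := by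
  have hp : (0 : ℝ) < 2 * Real.pi := Real.two_pi_pos
  refine ⟨fun μ => toIocMod hp (-Real.pi) (k μ), ?_, fun r => ?_⟩
  · rw [BZ, Set.mem_Icc]
    constructor <;> intro μ <;> have h := toIocMod_mem_Ioc hp (-Real.pi) (k μ)
    · exact h.1.le
    · have := h.2
      dsimp only
      linarith
  · have : dotK (fun μ => toIocMod hp (-Real.pi) (k μ)) r =
        dotK k r - ((∑ μ, toIocDiv hp (-Real.pi) (k μ) * r μ : ℤ) : ℝ) * (2 * Real.pi) := by
      simp only [dotK, toIocMod, zsmul_eq_mul]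
      push_cast
      rw [Finset.sum_mul, ← Finset.sum_sub_distrib]
      exact Finset.sum_congr rfl fun μ _ => by ring
    rw [this, Real.cos_sub_int_mul_two_pi]

/-- First entry of the normalized positive eigenvector of `[[κ, δ], [-δ, -κ]]`. -/
def bogA (κ μ : ℝ) : ℝ := Real.sqrt ((κ / μ + 1) / 2)

/-- Second entry of the normalized positive eigenvector of `[[κ, δ], [-δ, -κ]]`. -/
def bogB (κ δ μ : ℝ) : ℝ := -δ / (2 * bogA κ μ * μ)

/-- Normalization forces `κ / μ = a² + b²`, whence the formula for `a`; this is why `κ` and `μ` must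
have the same sign for the Krein signature to be `+1`. -/
lemma bog_spec {κ δ μ : ℝ} (hμ : μ ^ 2 = κ ^ 2 - δ ^ 2) (h : 0 < κ * μ) :
    bogA κ μ ^ 2 - bogB κ δ μ ^ 2 = 1 ∧
      κ * bogA κ μ + δ * bogB κ δ μ = μ * bogA κ μ ∧
      -δ * bogA κ μ - κ * bogB κ δ μ = μ * bogB κ δ μ := by
  have hμ0 : μ ≠ 0 := by rintro rfl; simp at h
  have hdiv : 0 < κ / μ := by
    have : κ / μ = κ * μ / μ ^ 2 := by field_simp
    rw [this]; positivity
  have ha0 : 0 < bogA κ μ := Real.sqrt_pos.mpr (by positivity)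
  have ha2 : bogA κ μ ^ 2 = (κ / μ + 1) / 2 := Real.sq_sqrt (by positivity)
  have ha2' : 2 * bogA κ μ ^ 2 * μ = κ + μ := by rw [ha2]; field_simp
  have hb : bogB κ δ μ * (2 * bogA κ μ * μ) = -δ := by
    unfold bogB; field_simp
  set a := bogA κ μ
  set b := bogB κ δ μ
  have h2 : κ * a + δ * b = μ * a := by
    have : (2 * a * μ) * (κ * a + δ * b) = (2 * a * μ) * (μ * a) := by
      linear_combination δ * hb + (κ - μ) * ha2' - hμ
    exact mul_left_cancel₀ (by positivity) this
  have h3 : -δ * a - κ * b = μ * b := by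
    linear_combination b * ha2' - a * hb
  refine ⟨?_, h2, h3⟩
  have h4 : μ * (a ^ 2 - b ^ 2) = μ * 1 := by
    have : (2 * a * a * μ) * (μ * (a ^ 2 - b ^ 2)) = (2 * a * a * μ) * (μ * 1) := by
      have e1 : 4 * a ^ 2 * μ ^ 2 * b ^ 2 = δ ^ 2 := by
        linear_combination (2 * a * b * μ - δ) * hb
      linear_combination (1 / 2) * (2 * a ^ 2 * μ + κ - μ) * ha2' - (1 / 2) * e1 - (1 / 2) * hμ
    exact mul_left_cancel₀ (by positivity) this
  exact mul_left_cancel₀ hμ0 h4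

namespace QBH

variable {D R : ℕ} (H : QBH D R)

/-- The even part of `K(k)`. -/
def kap (k : Momentum D) : ℝ := ∑ r ∈ box D R, (H.K r).re * Real.cos (dotK k r)

/-- The odd part of `K(k)`. -/
def eta (k : Momentum D) : ℝ := -∑ r ∈ box D R, (H.K r).im * Real.sin (dotK k r)

/-- The real part of `Δ(k)`. -/
def del (k : Momentum D) : ℝ := ∑ r ∈ box D R, (H.Δ r).re * Real.cos (dotK k r)

lemma kap_neg (k : Momentum D) : H.kap (-k) = H.kap k := by simp [kap, neg_dotK]

lemma del_neg (k : Momentum D) : H.del (-k) = H.del k := by simp [del, neg_dotK]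

lemma eta_neg (k : Momentum D) : H.eta (-k) = -H.eta k := by simp [eta, neg_dotK]

lemma X_eq (k : Momentum D) : H.X k = H.kap k + H.del k := by
  simp [X, symbol, Hxx, kap, del, add_mul, Finset.sum_add_distrib]

lemma P_eq (k : Momentum D) : H.P k = H.kap k - H.del k := by
  simp [P, symbol, Hpp, kap, del, sub_mul, Finset.sum_sub_distrib]

lemma exp_mul_re_im (x : ℝ) (z : ℂ) : Complex.exp (Complex.I * x) * z =
    ((z.re * Real.cos x - z.im * Real.sin x : ℝ) : ℂ) +
      ((z.re * Real.sin x + z.im * Real.cos x : ℝ) : ℂ) * Complex.I := by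
  apply Complex.ext <;> rw [mul_comm Complex.I] <;>
    simp [Complex.exp_ofReal_mul_I_re, Complex.exp_ofReal_mul_I_im, -Complex.ofReal_cos,
      -Complex.ofReal_sin, -Complex.ofReal_add, -Complex.ofReal_sub, -Complex.ofReal_mul] <;> ring

/-- `K_{-r}` being the conjugate of `K_r` makes the imaginary part of each summand odd in `r`. -/
lemma Khat_eq (k : Momentum D) : H.Khat k = ((H.kap k + H.eta k : ℝ) : ℂ) := by
  simp only [Khat, exp_mul_re_im]
  rw [Finset.sum_add_distrib, ← Finset.sum_mul, ← Complex.ofReal_sum, ← Complex.ofReal_sum,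
    sum_box_odd (f := fun r => (H.K r).re * Real.sin (dotK k r) + (H.K r).im * Real.cos (dotK k r)),
    Finset.sum_sub_distrib]
  · simp [kap, eta, sub_eq_add_neg]
  · intro r
    simp only [H.K_neg, dotK_neg, Real.sin_neg, Real.cos_neg, Complex.conj_re, Complex.conj_im]
    ring

variable {H}

/-- In the entry `(0, r)` the imaginary parts of `K_r` and `K_{-r}` cancel, those of `Δ_r` and
`Δ_{-r}` add. -/
lemma im_Δ_eq_zero (hxp : H.Hxp + H.Hxpᵀ = 0) (r : Site D) : (H.Δ r).im = 0 := by
  have h := congrFun (congrFun hxp 0) r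
  simp only [Matrix.add_apply, Matrix.transpose_apply, Hxp, Matrix.of_apply, sub_zero, zero_sub,
    Matrix.zero_apply, H.K_neg, H.Δ_neg, Complex.sub_im, Complex.conj_im] at h
  linarith

lemma Δhat_eq (hxp : H.Hxp + H.Hxpᵀ = 0) (k : Momentum D) : H.Δhat k = (H.del k : ℂ) := by
  simp only [Δhat, exp_mul_re_im, im_Δ_eq_zero hxp]
  rw [Finset.sum_add_distrib, ← Finset.sum_mul, ← Complex.ofReal_sum, ← Complex.ofReal_sum,
    sum_box_odd (f := fun r => (H.Δ r).re * Real.sin (dotK k r) + 0 * Real.cos (dotK k r))]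
  · simp [del]
  · intro r
    simp [H.Δ_neg, dotK_neg]

lemma g_eq (hxp : H.Hxp + H.Hxpᵀ = 0) (k : Momentum D) :
    H.g k = !![((H.kap k + H.eta k : ℝ) : ℂ), (H.del k : ℂ);
      ((-H.del k : ℝ) : ℂ), ((-H.kap k + H.eta k : ℝ) : ℂ)] := by
  have h : -(-H.eta k + H.kap k) = -H.kap k + H.eta k := by ring
  rw [g, Khat_eq, Khat_eq, Δhat_eq hxp, Δhat_eq hxp, Complex.conj_ofReal, Complex.conj_ofReal,
    kap_neg, del_neg, eta_neg, ← Complex.ofReal_neg, ← Complex.ofReal_neg, ← h, add_comm (-H.eta k)]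

/-- Real eigenvalues make the discriminant `4 (κ² - δ²)` of `g(k)` a square. If it vanishes, a
diagonalizable `g(k)` is scalar, which excludes `δ ≠ 0`. -/
lemma sq_del_le_of_stable (hxp : H.Hxp + H.Hxpᵀ = 0) (hs : H.DynamicallyStable)
    (k : Momentum D) : H.del k ^ 2 ≤ H.kap k ^ 2 ∧
      (H.del k ^ 2 = H.kap k ^ 2 → H.del k = 0 ∧ H.kap k = 0) := by
  obtain ⟨S, e, hS, h⟩ := hs k
  have hg : H.g k = S * Matrix.diagonal (fun n => (e n : ℂ)) * S⁻¹ := by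
    rw [← h, Matrix.mul_assoc, Matrix.mul_nonsing_inv _ hS, Matrix.mul_one]
  have htr : 2 * H.eta k = e 0 + e 1 := by
    have h1 : (H.g k).trace = (Matrix.diagonal (fun n => (e n : ℂ))).trace := by
      rw [hg, Matrix.trace_mul_comm, ← Matrix.mul_assoc, Matrix.nonsing_inv_mul _ hS,
        Matrix.one_mul]
    rw [g_eq hxp, Matrix.trace_fin_two, Matrix.trace_fin_two] at h1
    simp only [Matrix.of_apply, Matrix.cons_val', Matrix.cons_val_zero, Matrix.cons_val_one,
      Matrix.diagonal_apply_eq] at h1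
    have h2 : (H.kap k + H.eta k) + (-H.kap k + H.eta k) = e 0 + e 1 := by exact_mod_cast h1
    linarith
  have hdet : H.eta k ^ 2 - H.kap k ^ 2 + H.del k ^ 2 = e 0 * e 1 := by
    have h1 : (H.g k).det = (Matrix.diagonal (fun n => (e n : ℂ))).det := by
      have h2 := congrArg Matrix.det h
      rw [Matrix.det_mul, Matrix.det_mul, mul_comm] at h2
      exact mul_left_cancel₀ hS.ne_zero h2
    rw [g_eq hxp, Matrix.det_fin_two_of, Matrix.det_diagonal, Fin.prod_univ_two] at h1
    have h2 : (H.kap k + H.eta k) * (-H.kap k + H.eta k) - H.del k * -H.del k = e 0 * e 1 := by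
      exact_mod_cast h1
    linarith
  have hdisc : 4 * (H.kap k ^ 2 - H.del k ^ 2) = (e 0 - e 1) ^ 2 := by
    linear_combination -4 * hdet + (2 * H.eta k + e 0 + e 1) * htr
  refine ⟨by nlinarith [sq_nonneg (e 0 - e 1)], fun heq => ?_⟩
  have he : e 0 = e 1 := by
    rw [heq, sub_self, mul_zero] at hdisc
    exact sub_eq_zero.mp (pow_eq_zero_iff two_ne_zero |>.mp hdisc.symm)
  have hd : Matrix.diagonal (fun n => (e n : ℂ)) = (e 0 : ℂ) • (1 : Matrix (Fin 2) (Fin 2) ℂ) := by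
    ext i j
    fin_cases i <;> fin_cases j <;> simp [he]
  rw [hd, Matrix.mul_smul, Matrix.mul_one, Matrix.smul_mul, Matrix.mul_nonsing_inv _ hS,
    g_eq hxp] at hg
  have h01 := congrFun (congrFun hg 0) 1
  simp at h01
  refine ⟨h01, ?_⟩
  rw [h01] at heq
  simpa using heq.symm

/-- The energy of the quasiparticles, up to the odd part of `K(k)`. -/
def mu (H : QBH D R) (k : Momentum D) : ℝ :=
  if 0 < H.kap k then Real.sqrt (H.kap k ^ 2 - H.del k ^ 2)
  else -Real.sqrt (H.kap k ^ 2 - H.del k ^ 2)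

lemma mu_neg (k : Momentum D) : H.mu (-k) = H.mu k := by simp only [mu, kap_neg, del_neg]

/-- Giving `mu` the sign of `κ` selects the eigenvalue of Krein signature `+1`. -/
lemma mu_spec {k : Momentum D} (h : H.del k ^ 2 < H.kap k ^ 2) :
    H.mu k ^ 2 = H.kap k ^ 2 - H.del k ^ 2 ∧ 0 < H.kap k * H.mu k := by
  have hs := Real.sq_sqrt (sub_nonneg.mpr h.le)
  have hp := Real.sqrt_pos.mpr (sub_pos.mpr h)
  have hk : H.kap k ≠ 0 := by
    intro h0
    rw [h0] at h
    nlinarith [sq_nonneg (H.del k)]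
  unfold mu
  split_ifs with h0
  · exact ⟨hs, mul_pos h0 hp⟩
  · refine ⟨by rw [neg_sq, hs], ?_⟩
    have : H.kap k < 0 := lt_of_le_of_ne (not_lt.mp h0) hk
    nlinarith

lemma isQuasiparticleEnergy (hxp : H.Hxp + H.Hxpᵀ = 0) {k : Momentum D}
    (h : H.del k ^ 2 < H.kap k ^ 2) : H.IsQuasiparticleEnergy k (H.eta k + H.mu k) := by
  obtain ⟨hμ, hκ⟩ := mu_spec h
  obtain ⟨h1, h2, h3⟩ := bog_spec hμ hκ
  refine ⟨![(bogA (H.kap k) (H.mu k) : ℂ), (bogB (H.kap k) (H.del k) (H.mu k) : ℂ)], ?_, ?_⟩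
  · rw [g_eq hxp]
    ext i
    fin_cases i
    · simp only [Matrix.mulVec, dotProduct, Fin.sum_univ_two]
      simp
      norm_cast
      linear_combination h2
    · simp only [Matrix.mulVec, dotProduct, Fin.sum_univ_two]
      simp
      norm_cast
      linear_combination h3
  · simp only [τ₃, Matrix.mulVec, dotProduct, Fin.sum_univ_two]
    simp
    norm_cast
    linear_combination h1

/-- In this degenerate case the energy is odd in `k`, so it closes the Krein gap; a positive gap
therefore rules the case out. -/
lemma isQuasiparticleEnergy_of_zero (hxp : H.Hxp + H.Hxpᵀ = 0) {k : Momentum D}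
    (hd : H.del k = 0) (hk : H.kap k = 0) : H.IsQuasiparticleEnergy k (H.eta k) := by
  refine ⟨![1, 0], ?_, ?_⟩
  · rw [g_eq hxp, hd, hk]
    ext i
    fin_cases i <;> simp [Matrix.mulVec, dotProduct, Fin.sum_univ_two]
  · simp [τ₃, Matrix.mulVec, dotProduct, Fin.sum_univ_two]

lemma kreinGap_le {k : Momentum D} (hk : k ∈ BZ D) {ω ω' : ℝ}
    (h : H.IsQuasiparticleEnergy k ω) (h' : H.IsQuasiparticleEnergy (-k) ω') :
    H.kreinGap ≤ |ω + ω'| := by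
  refine csInf_le ⟨0, ?_⟩ ⟨k, hk, ω, ω', h, h', rfl⟩
  rintro x ⟨-, -, -, -, -, -, rfl⟩
  exact abs_nonneg _

/-- A positive Krein gap bounds the product of the two symbols from below. -/
theorem sq_kreinGap_le (hxp : H.Hxp + H.Hxpᵀ = 0) (hs : H.DynamicallyStable)
    (hgap : 0 < H.kreinGap) (k : Momentum D) : H.kreinGap ^ 2 ≤ 4 * (H.X k * H.P k) := by
  -- The gap is an infimum over the Brillouin zone only; periodicity of the cosines carries the
  -- bound to every momentum.
  obtain ⟨k', hk', hcos⟩ := exists_mem_BZ k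
  have hκ : H.kap k = H.kap k' := by simp only [kap, hcos]
  have hδ : H.del k = H.del k' := by simp only [del, hcos]
  have hXP : H.X k * H.P k = H.kap k' ^ 2 - H.del k' ^ 2 := by
    rw [X_eq, P_eq, hκ, hδ]; ring
  obtain ⟨hle, heq⟩ := sq_del_le_of_stable hxp hs k'
  rcases hle.eq_or_lt with h | h
  · obtain ⟨hd, hk⟩ := heq h
    have h1 := kreinGap_le hk' (isQuasiparticleEnergy_of_zero hxp hd hk)
      (isQuasiparticleEnergy_of_zero hxp (k := -k') (by rw [del_neg, hd]) (by rw [kap_neg, hk]))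
    rw [eta_neg, add_neg_cancel, abs_zero] at h1
    linarith
  · have h1 := kreinGap_le hk' (isQuasiparticleEnergy hxp h)
      (isQuasiparticleEnergy hxp (k := -k') (by rwa [del_neg, kap_neg]))
    rw [eta_neg, mu_neg] at h1
    have h2 : H.eta k' + H.mu k' + (-H.eta k' + H.mu k') = 2 * H.mu k' := by ring
    rw [h2] at h1
    rw [hXP, ← (mu_spec h).1]
    calc H.kreinGap ^ 2 ≤ |2 * H.mu k'| ^ 2 := by gcongr
      _ = 4 * H.mu k' ^ 2 := by rw [sq_abs]; ring

lemma X_mul_P_pos (hxp : H.Hxp + H.Hxpᵀ = 0) (hs : H.DynamicallyStable)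
    (hgap : 0 < H.kreinGap) (k : Momentum D) : 0 < H.X k * H.P k := by
  have := sq_kreinGap_le hxp hs hgap k
  nlinarith [sq_pos_of_pos hgap]

lemma sq_del_lt (hpos : ∀ k, 0 < H.X k * H.P k) (k : Momentum D) :
    H.del k ^ 2 < H.kap k ^ 2 := by
  have := hpos k
  rw [X_eq, P_eq] at this
  linarith

/-- The matrix `[[a, b], [b, a]]` built from `bogA` and `bogB` is real, even in `k` and commutes
with `τ₁`, so the reality condition is automatic. -/
lemma nonempty_bogoliubov (hxp : H.Hxp + H.Hxpᵀ = 0) (hpos : ∀ k, 0 < H.X k * H.P k) :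
    Nonempty H.Bogoliubov := by
  refine ⟨⟨fun k => !![(bogA (H.kap k) (H.mu k) : ℂ), (bogB (H.kap k) (H.del k) (H.mu k) : ℂ);
      (bogB (H.kap k) (H.del k) (H.mu k) : ℂ), (bogA (H.kap k) (H.mu k) : ℂ)],
    fun k => H.eta k + H.mu k, fun k => ?_, fun k => ?_, fun k => ?_⟩⟩
  · rw [kap_neg, del_neg, mu_neg]
    ext i j
    fin_cases i <;> fin_cases j <;> simp [τ₁, Matrix.mul_apply, Fin.sum_univ_two]
  · obtain ⟨hμ, hκ⟩ := mu_spec (sq_del_lt hpos k)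
    obtain ⟨h1, h2, h3⟩ := bog_spec hμ hκ
    have h1' : (bogA (H.kap k) (H.mu k) : ℂ) ^ 2 -
        (bogB (H.kap k) (H.del k) (H.mu k) : ℂ) ^ 2 = 1 := by exact_mod_cast h1
    ext i j
    fin_cases i <;> fin_cases j <;> simp [τ₃, Matrix.mul_apply, Fin.sum_univ_two]
    · linear_combination h1'
    · ring
    · ring
    · linear_combination -h1'
  · obtain ⟨hμ, hκ⟩ := mu_spec (sq_del_lt hpos k)
    obtain ⟨h1, h2, h3⟩ := bog_spec hμ hκ
    rw [g_eq hxp, eta_neg, mu_neg]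
    ext i j
    fin_cases i <;> fin_cases j <;> simp [Matrix.mul_apply, Fin.sum_univ_two] <;>
      norm_cast <;> first | linear_combination h2 | linear_combination h3 |
        linear_combination -h2 | linear_combination -h3

/-- The momentum-space covariance matrix of the quasiparticle vacuum. -/
theorem Bogoliubov.cov_eq (hxp : H.Hxp + H.Hxpᵀ = 0) (hpos : ∀ k, 0 < H.X k * H.P k)
    (Q : H.Bogoliubov) (k : Momentum D) :
    quadUᴴ * Q.L k * (Q.L k)ᴴ * quadU =
      !![(((H.X k / H.P k) ^ (-(1 / 2) : ℝ) : ℝ) : ℂ), 0;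
        0, (((H.X k / H.P k) ^ (1 / 2 : ℝ) : ℝ) : ℂ)] := by
  have hpu := Q.pseudoUnitary k
  have hdiag := Q.diagonalizes k
  have hp := hpos k
  set L := Q.L k with hL
  set w := Q.ω k
  set w' := Q.ω (-k)
  have hττ : τ₃ * τ₃ = 1 := by
    ext i j; fin_cases i <;> fin_cases j <;> simp [τ₃, Matrix.mul_apply, Fin.sum_univ_two]
  have hinv : L * (τ₃ * Lᴴ * τ₃) = 1 := by
    rw [mul_eq_one_comm, Matrix.mul_assoc, Matrix.mul_assoc, ← Matrix.mul_assoc Lᴴ, hpu, hττ]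
  have hΛ : Matrix.diagonal ![(w : ℂ), -(w' : ℂ)] =
      (((w - w') / 2 : ℝ) : ℂ) • 1 + (((w + w') / 2 : ℝ) : ℂ) • τ₃ := by
    ext i j
    fin_cases i <;> fin_cases j <;> simp [τ₃] <;> ring
  -- As `L⁻¹ = τ₃ L† τ₃`, the `τ₃` part of the spectrum conjugates to `L L† τ₃`. Solving for `L L†`
  -- eliminates the freedom in `L`.
  have hgM : H.g k = (((w - w') / 2 : ℝ) : ℂ) • 1 +
      (((w + w') / 2 : ℝ) : ℂ) • (L * Lᴴ * τ₃) := by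
    calc H.g k = H.g k * L * (τ₃ * Lᴴ * τ₃) := by rw [Matrix.mul_assoc, hinv, Matrix.mul_one]
      _ = (((w - w') / 2 : ℝ) : ℂ) • (L * (τ₃ * Lᴴ * τ₃)) +
          (((w + w') / 2 : ℝ) : ℂ) • (L * (τ₃ * τ₃) * Lᴴ * τ₃) := by
        rw [hdiag, hΛ]
        simp only [Matrix.mul_add, Matrix.add_mul, Matrix.mul_smul, Matrix.smul_mul,
          Matrix.mul_one, Matrix.mul_assoc]
      _ = _ := by rw [hinv, hττ, Matrix.mul_one]
  have htr : 2 * H.eta k = w - w' := by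
    have h1 : (H.g k).trace = (Matrix.diagonal ![(w : ℂ), -(w' : ℂ)]).trace := by
      have : H.g k = L * Matrix.diagonal ![(w : ℂ), -(w' : ℂ)] * (τ₃ * Lᴴ * τ₃) := by
        rw [← hdiag, Matrix.mul_assoc, hinv, Matrix.mul_one]
      rw [this, Matrix.trace_mul_comm, ← Matrix.mul_assoc, mul_eq_one_comm.mp hinv, Matrix.one_mul]
    rw [g_eq hxp, Matrix.trace_fin_two, Matrix.trace_fin_two] at h1
    simp only [Matrix.of_apply, Matrix.cons_val', Matrix.cons_val_zero, Matrix.cons_val_one,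
      Matrix.diagonal_apply_eq, Matrix.cons_val_fin_one] at h1
    have h2 : (H.kap k + H.eta k) + (-H.kap k + H.eta k) = w + -w' := by exact_mod_cast h1
    linarith
  have hη : (w - w') / 2 = H.eta k := by linarith
  set μ := (w + w') / 2 with hμ
  rw [hη, g_eq hxp] at hgM
  set M := L * Lᴴ with hM
  have e00 := congrFun (congrFun hgM 0) 0
  have e01 := congrFun (congrFun hgM 0) 1
  have e10 := congrFun (congrFun hgM 1) 0
  have e11 := congrFun (congrFun hgM 1) 1
  simp [τ₃, Matrix.mul_apply, Fin.sum_univ_two] at e00 e01 e10 e11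
  have hM00 : M 0 0 = ((Complex.normSq (L 0 0) + Complex.normSq (L 0 1) : ℝ) : ℂ) := by
    simp [hM, Matrix.mul_apply, Fin.sum_univ_two, Complex.mul_conj]
  have hdetM : M 0 0 * M 1 1 - M 0 1 * M 1 0 = 1 := by
    have h1 := congrArg Matrix.det hpu
    rw [Matrix.det_mul, Matrix.det_mul] at h1
    have h2 : Matrix.det τ₃ = -1 := by simp [τ₃, Matrix.det_fin_two]
    rw [h2] at h1
    rw [← Matrix.det_fin_two, hM, Matrix.det_mul]
    linear_combination -h1
  set s := Complex.normSq (L 0 0) + Complex.normSq (L 0 1) with hs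
  have hs0 : 0 ≤ s := add_nonneg (Complex.normSq_nonneg _) (Complex.normSq_nonneg _)
  rw [hM00] at e00
  -- This comes from `det (L L†) = 1`. The sign of `μ` stays open; it cancels in the ratio `X / P`.
  have hμ2 : μ ^ 2 = H.kap k ^ 2 - H.del k ^ 2 := by
    have : ((μ ^ 2 : ℝ) : ℂ) = ((H.kap k ^ 2 - H.del k ^ 2 : ℝ) : ℂ) := by
      rw [hM00] at hdetM
      push_cast at e00 hdetM ⊢
      linear_combination (-(μ : ℂ) ^ 2) * hdetM - μ * M 1 1 * e00 + H.kap k * e11 -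
        μ * M 1 0 * e01 - H.del k * e10
    exact_mod_cast this
  have hμ0 : μ ≠ 0 := by
    intro h0
    rw [X_eq, P_eq] at hp
    rw [h0] at hμ2
    nlinarith
  have hμ0' : (μ : ℂ) ≠ 0 := by exact_mod_cast hμ0
  set d := -H.del k / μ with hd
  have hs' : H.kap k = μ * s := by
    have : ((H.kap k : ℝ) : ℂ) = ((μ * s : ℝ) : ℂ) := by
      push_cast at e00 ⊢; linear_combination e00
    exact_mod_cast this
  have hd' : H.del k = -(μ * d) := by rw [hd]; field_simp
  have hM01 : M 0 1 = d := by
    apply mul_left_cancel₀ hμ0'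
    rw [hd'] at e01
    push_cast at e01
    linear_combination e01
  have hM10 : M 1 0 = d := by
    apply mul_left_cancel₀ hμ0'
    rw [hd'] at e10
    push_cast at e10
    linear_combination -e10
  have hM11 : M 1 1 = s := by
    apply mul_left_cancel₀ hμ0'
    rw [hs'] at e11
    push_cast at e11 ⊢
    linear_combination e11
  have hsd : (s + d) * (s - d) = 1 := by
    have h1 : μ ^ 2 * ((s + d) * (s - d)) = μ ^ 2 * 1 := by
      rw [mul_one]; nth_rewrite 2 [hμ2]; rw [hs', hd']; ring
    exact mul_left_cancel₀ (pow_ne_zero 2 hμ0) h1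
  -- `s ≥ 0` is a diagonal entry of `L L†`, so the two factors of `(s + d)(s - d) = 1` are positive.
  -- This fixes the branch of the square root.
  have hpos1 : 0 < s - d := by
    by_contra hneg
    nlinarith
  have hV : H.X k / H.P k = (s - d) ^ 2 := by
    have h1 : s + d ≠ 0 := left_ne_zero_of_mul_eq_one hsd
    rw [X_eq, P_eq, hs', hd']
    rw [div_eq_iff (by rw [show μ * s - -(μ * d) = μ * (s + d) by ring]; positivity)]
    linear_combination -(μ * (s - d)) * hsd
  have hhalf : (H.X k / H.P k) ^ (1 / 2 : ℝ) = s - d := by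
    rw [hV, ← Real.sqrt_eq_rpow, Real.sqrt_sq hpos1.le]
  have hneg : (H.X k / H.P k) ^ (-(1 / 2) : ℝ) = s + d := by
    rw [Real.rpow_neg (by rw [hV]; positivity), hhalf]
    exact (eq_inv_of_mul_eq_one_left hsd).symm
  have hMeq : M = !![(s : ℂ), d; d, s] := by
    ext i j
    fin_cases i <;> fin_cases j <;> simp [hM00, hM01, hM10, hM11]
  have h2 : (((Real.sqrt 2 : ℝ) : ℂ)⁻¹) * (((Real.sqrt 2 : ℝ) : ℂ)⁻¹) = 1 / 2 := by
    rw [← mul_inv, ← Complex.ofReal_mul, Real.mul_self_sqrt (by norm_num)]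
    norm_num
  rw [hhalf, hneg, Matrix.mul_assoc quadUᴴ, ← hM, hMeq, quadU, Matrix.conjTranspose_smul,
    Matrix.smul_mul, Matrix.smul_mul, Matrix.mul_smul, smul_smul]
  have h3 : star (((Real.sqrt 2 : ℝ) : ℂ)⁻¹) = ((Real.sqrt 2 : ℝ) : ℂ)⁻¹ := by
    simp
  rw [h3, h2]
  ext i j
  fin_cases i <;> fin_cases j <;>
    simp [Matrix.mul_apply, Fin.sum_univ_two] <;> (ring_nf; try simp [Complex.I_sq]; try ring)

end QBH

/-! ### Exponential decay of correlations -/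

/-- A pair of positive trigonometric polynomials of degree `R`, bounded by `a` and `b`, with
product bounded from below by `(E / 2)²`. -/
structure GappedPair (D R : ℕ) (x p : Momentum D → ℝ) (a b E : ℝ) : Prop where
  mem_left : x ∈ trigPoly D R
  mem_right : p ∈ trigPoly D R
  pos_left : ∀ k, 0 < x k
  pos_right : ∀ k, 0 < p k
  le_left : ∀ k, x k ≤ a
  le_right : ∀ k, p k ≤ b
  gap_pos : 0 < E
  gap_le : ∀ k, E ^ 2 ≤ 4 * (x k * p k)

namespace GappedPair

variable {D R : ℕ} {x p : Momentum D → ℝ} {a b E : ℝ}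

lemma symm (h : GappedPair D R x p a b E) : GappedPair D R p x b a E :=
  ⟨h.mem_right, h.mem_left, h.pos_right, h.pos_left, h.le_right, h.le_left, h.gap_pos,
    fun k => by rw [mul_comm (p k)]; exact h.gap_le k⟩

lemma left_pos (h : GappedPair D R x p a b E) : 0 < a := (h.pos_left 0).trans_le (h.le_left 0)

lemma gap_le_sqrt (h : GappedPair D R x p a b E) : E ≤ 2 * Real.sqrt (a * b) := by
  have h1 : E ^ 2 ≤ 4 * (a * b) := (h.gap_le 0).trans (by
    have := mul_le_mul (h.le_left 0) (h.le_right 0) (h.pos_right 0).le h.left_pos.le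
    linarith)
  have h2 : (2 * Real.sqrt (a * b)) ^ 2 = 4 * (a * b) := by
    rw [mul_pow, Real.sq_sqrt (mul_pos h.left_pos h.symm.left_pos).le]; norm_num
  exact le_of_sq_le_sq (h1.trans h2.ge) (by positivity)

lemma continuous_sqrt_div (h : GappedPair D R x p a b E) :
    Continuous fun k => Real.sqrt (x k / p k) :=
  ((continuous_of_mem_trigPoly h.mem_left).div (continuous_of_mem_trigPoly h.mem_right)
    fun k => (h.pos_right k).ne').sqrt

/-- Removes the quotient: only the inverse square root of the trigonometric polynomial `x p` remains
to be approximated. -/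
lemma sqrt_div_eq (h : GappedPair D R x p a b E) (k : Momentum D) :
    Real.sqrt (x k / p k) = x k * (1 / Real.sqrt (x k * p k)) := by
  have hx := h.pos_left k
  have hp := h.pos_right k
  have h1 : x k / p k = x k ^ 2 / (x k * p k) := by field_simp
  rw [h1, Real.sqrt_div (by positivity), Real.sqrt_sq hx.le, mul_one_div]

lemma sqrt_div_le (h : GappedPair D R x p a b E) (k : Momentum D) :
    Real.sqrt (x k / p k) ≤ 2 * a / E := by
  have hE := h.gap_pos
  have hx := h.pos_left k
  rw [h.sqrt_div_eq k]
  have h1 : E / 2 ≤ Real.sqrt (x k * p k) := by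
    apply Real.le_sqrt_of_sq_le
    have := h.gap_le k
    linarith
  calc x k * (1 / Real.sqrt (x k * p k)) ≤ a * (1 / (E / 2)) := by
        gcongr
        · exact h.left_pos.le
        · exact h.le_left k
    _ = 2 * a / E := by field_simp

lemma exists_approx (h : GappedPair D R x p a b E) (n : ℕ) :
    ∃ f ∈ trigPoly D (R + (n - 1) * (R + R)), ∀ k, |Real.sqrt (x k / p k) - f k| ≤
      4 * a / E * Real.exp (-(E / (4 * Real.sqrt (a * b)) * n)) := by
  have hE := h.gap_pos
  have ha := h.left_pos
  have hb := h.symm.left_pos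
  have hEN := h.gap_le_sqrt
  set N := Real.sqrt (a * b) with hN
  have hN0 : 0 < N := Real.sqrt_pos.mpr (mul_pos ha hb)
  have hu : Real.sqrt ((E / 4) ^ 2) = E / 4 := Real.sqrt_sq (by positivity)
  -- The lower end could be `(E / 2)²`, but that may equal `a b` when the symbols are constant; `E /
  -- 4` keeps the interval nondegenerate.
  have hmM : (E / 4) ^ 2 < a * b := by
    have : N ^ 2 = a * b := Real.sq_sqrt (mul_pos ha hb).le
    rw [← this]
    gcongr
    linarith
  obtain ⟨q, hq, hqa⟩ := exists_polynomial_approx_inv_sqrt (by positivity) hmM n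
  rw [hu, ← hN] at hqa
  refine ⟨_, mul_eval_mem_trigPoly h.mem_left (mul_mem_trigPoly h.mem_left h.mem_right) hq,
    fun k => ?_⟩
  have hx := h.pos_left k
  have hW : x k * p k ∈ Set.Icc ((E / 4) ^ 2) (a * b) := by
    constructor
    · have := h.gap_le k
      nlinarith
    · exact mul_le_mul (h.le_left k) (h.le_right k) (h.pos_right k).le ha.le
  rw [h.sqrt_div_eq k, Pi.mul_apply, ← mul_sub, abs_mul, abs_of_pos hx]
  -- With `e = E / 4 ≤ N`, the ratio is `1 - 2e / (N + e) ≤ exp(-2e / (N + e)) ≤ exp(-e / N)`.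
  have hρ : (N - E / 4) / (N + E / 4) ≤ Real.exp (-(E / (4 * N))) := by
    have h1 : (N - E / 4) / (N + E / 4) = -(2 * (E / 4) / (N + E / 4)) + 1 := by
      field_simp; ring
    rw [h1]
    refine (Real.add_one_le_exp _).trans (Real.exp_le_exp.mpr (neg_le_neg ?_))
    rw [div_le_div_iff₀ (by positivity) (by positivity)]
    nlinarith
  have hρ0 : 0 ≤ (N - E / 4) / (N + E / 4) := div_nonneg (by linarith) (by linarith)
  calc x k * |1 / Real.sqrt (x k * p k) - q.eval (x k * p k)|
      ≤ a * (Real.exp (-(E / (4 * N))) ^ n / (E / 4)) := by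
        refine mul_le_mul (h.le_left k) ((hqa _ hW).trans ?_) (abs_nonneg _) ha.le
        gcongr
    _ = 4 * a / E * Real.exp (-(E / (4 * N) * n)) := by
        rw [← Real.exp_nat_mul]
        rw [show (n : ℝ) * -(E / (4 * N)) = -(E / (4 * N) * n) by ring]
        field_simp

lemma exists_approx_of_pos (h : GappedPair D R x p a b E) {ε : ℝ} (hε : 0 < ε) :
    ∃ N, ∃ f ∈ trigPoly D N, ∀ k, |Real.sqrt (x k / p k) - f k| ≤ ε := by
  have hE := h.gap_pos
  have ha := h.left_pos
  have hb := h.symm.left_pos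
  set t := E / (4 * Real.sqrt (a * b)) with ht
  have ht0 : 0 < t := by positivity
  have hlim : Filter.Tendsto (fun n : ℕ => 4 * a / E * Real.exp (-(t * n))) Filter.atTop
      (nhds (4 * a / E * 0)) := by
    refine Filter.Tendsto.const_mul _ (Real.tendsto_exp_neg_atTop_nhds_zero.comp ?_)
    exact tendsto_natCast_atTop_atTop.const_mul_atTop ht0
  rw [mul_zero] at hlim
  obtain ⟨n, hn⟩ := (hlim.eventually (ge_mem_nhds hε)).exists
  obtain ⟨f, hf, hfa⟩ := h.exists_approx n
  exact ⟨_, f, hf, fun k => (hfa k).trans hn⟩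

/-- Exponential decay of the Fourier coefficients of `√(x / p)`. -/
theorem abs_coeff_le (h : GappedPair D R x p a b E) (hR : 1 ≤ R) {c : ℝ} (hc : 16 ≤ c)
    (r : Site D) : |coeff (fun k => Real.sqrt (x k / p k)) r| ≤
      c * a / E * Real.exp (-(len r : ℝ) / (c * R * Real.sqrt (a * b) / E)) := by
  have hE := h.gap_pos
  have ha := h.left_pos
  have hb := h.symm.left_pos
  have hEN := h.gap_le_sqrt
  set N := Real.sqrt (a * b) with hN
  have hN0 : 0 < N := Real.sqrt_pos.mpr (mul_pos ha hb)
  have hR' : (1 : ℝ) ≤ R := by exact_mod_cast hR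
  have hc0 : 0 < c := by linarith
  -- Within the range `R` the decay factor is at least `1/2`, and the uniform bound on the symbol is
  -- enough.
  by_cases hr : len r ≤ R
  · have hr' : (len r : ℝ) ≤ R := by exact_mod_cast hr
    have h1 := Krein.abs_coeff_le h.continuous_sqrt_div (c := 2 * a / E) (fun k => by
      rw [abs_of_nonneg (Real.sqrt_nonneg _)]; exact h.sqrt_div_le k) r
    refine h1.trans ?_
    have h2 : (len r : ℝ) / (c * R * N / E) ≤ 1 / 8 := by
      rw [div_div_eq_mul_div, div_le_div_iff₀ (by positivity) (by norm_num)]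
      have : (len r : ℝ) * E ≤ R * (2 * N) := mul_le_mul hr' hEN hE.le (by positivity)
      have h3 : 16 * (R * N) ≤ c * (R * N) := by gcongr
      linarith
    have h4 : 1 / 2 ≤ Real.exp (-(len r : ℝ) / (c * R * N / E)) := by
      refine le_trans ?_ (Real.add_one_le_exp _)
      rw [neg_div]
      linarith
    calc 2 * a / E = 4 * a / E * (1 / 2) := by ring
      _ ≤ c * a / E * Real.exp (-(len r : ℝ) / (c * R * N / E)) := by
        gcongr
        linarith
  · set n := (len r + R - 1) / (2 * R) with hn
    have hn1 : 1 ≤ n := by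
      rw [hn, Nat.le_div_iff_mul_le (by omega)]
      omega
    have hn2 : 2 * R * n ≤ len r + R - 1 := Nat.mul_div_le _ _
    have hn3 : len r + R - 1 < 2 * R * (n + 1) := Nat.lt_mul_div_succ _ (by omega)
    obtain ⟨f, hf, hfa⟩ := h.exists_approx n
    have hdeg : R + (n - 1) * (R + R) < len r := by
      obtain ⟨m, hm⟩ := Nat.exists_eq_add_of_le' hn1
      rw [hm] at hn2 ⊢
      rw [Nat.add_sub_cancel]
      have : 2 * R * (m + 1) = m * (R + R) + 2 * R := by ring
      omega
    have hcf : coeff (fun k => Real.sqrt (x k / p k) - f k) r =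
        coeff (fun k => Real.sqrt (x k / p k)) r := by
      rw [coeff_sub h.continuous_sqrt_div (continuous_of_mem_trigPoly hf),
        coeff_eq_zero_of_mem_trigPoly hf hdeg, sub_zero]
    have h1 := Krein.abs_coeff_le
      (h.continuous_sqrt_div.sub (continuous_of_mem_trigPoly hf)) hfa r
    rw [← hcf]
    refine LE.le.trans h1 ?_
    have hn4 : (len r : ℝ) - R ≤ 2 * R * n := by
      have : len r ≤ 2 * R * n + R := by
        rw [mul_add] at hn3
        omega
      have : (len r : ℝ) ≤ 2 * R * n + R := by exact_mod_cast this
      linarith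
    -- Rounding `n` down costs at most `1/4` in the exponent. The resulting factor is crudely
    -- bounded by `e ≤ 4`, which together with the prefactor `4` accounts for `16 ≤ c`.
    have h2 : -(E / (4 * N) * n) ≤ 1 + -(len r : ℝ) / (c * R * N / E) := by
      have e1 : (len r : ℝ) / (c * R * N / E) ≤ (len r : ℝ) / (8 * R * N / E) := by
        gcongr
        linarith
      have e2 : (len r : ℝ) / (8 * R * N / E) ≤ E / (4 * N) * n + 1 / 4 := by
        have : (len r : ℝ) / (8 * R * N / E) ≤ (2 * R * n + R) / (8 * R * N / E) := by
          gcongr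
          linarith
        refine this.trans ?_
        have e3 : (2 * R * n + R) / (8 * R * N / E) = E / (4 * N) * n + E / (8 * N) := by
          field_simp
          ring
        rw [e3]
        have e4 : E / (8 * N) ≤ 1 / 4 := by
          rw [div_le_div_iff₀ (by positivity) (by norm_num)]
          linarith
        linarith
      rw [neg_div]
      linarith
    have h3 : Real.exp 1 ≤ 4 := by
      have := Real.exp_one_lt_d9
      linarith
    calc 4 * a / E * Real.exp (-(E / (4 * N) * n))
        ≤ 4 * a / E * Real.exp (1 + -(len r : ℝ) / (c * R * N / E)) := by gcongr
      _ = Real.exp 1 * (4 * a / E * Real.exp (-(len r : ℝ) / (c * R * N / E))) := by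
        rw [Real.exp_add]; ring
      _ ≤ 4 * (4 * a / E * Real.exp (-(len r : ℝ) / (c * R * N / E))) := by gcongr
      _ = 16 * a / E * Real.exp (-(len r : ℝ) / (c * R * N / E)) := by ring
      _ ≤ c * a / E * Real.exp (-(len r : ℝ) / (c * R * N / E)) := by gcongr

end GappedPair

/-! ### The symbols of the Hamiltonian as a gapped pair -/

namespace QBH

lemma symbol_mem_trigPoly {D R : ℕ} {M : Matrix (Site D) (Site D) ℝ}
    (hM : ∀ r, R < len r → M 0 r = 0) : symbol R M ∈ trigPoly D R := by
  have : symbol R M = ∑ r ∈ box D R, M 0 r • fun k => Real.cos (dotK k r) := by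
    funext k
    simp [symbol, Finset.sum_apply]
  rw [this]
  refine Submodule.sum_mem _ fun r _ => ?_
  by_cases hr : len r ≤ R
  · exact Submodule.smul_mem _ _ (cos_mem_trigPoly hr)
  · rw [hM r (not_le.mp hr), zero_smul]
    exact Submodule.zero_mem _

lemma abs_symbol_le_opNorm {D R : ℕ} (M : Matrix (Site D) (Site D) ℝ) (k : Momentum D) :
    |symbol R M k| ≤ opNorm R M := by
  refine le_ciSup (f := fun k => |symbol R M k|) ⟨∑ r ∈ box D R, |M 0 r|, ?_⟩ k
  rintro _ ⟨k, rfl⟩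
  refine (Finset.abs_sum_le_sum_abs _ _).trans (Finset.sum_le_sum fun r _ => ?_)
  rw [abs_mul]
  exact mul_le_of_le_one_right (abs_nonneg _) (Real.abs_cos_le_one _)

variable {D R : ℕ} (H : QBH D R)

lemma X_mem_trigPoly : H.X ∈ trigPoly D R :=
  symbol_mem_trigPoly fun r hr => by simp [Hxx, H.K_range r hr, H.Δ_range r hr]

lemma P_mem_trigPoly : H.P ∈ trigPoly D R :=
  symbol_mem_trigPoly fun r hr => by simp [Hpp, H.K_range r hr, H.Δ_range r hr]

variable {H}

/-- Up to a common sign, the two symbols form a gapped pair. -/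
theorem exists_gappedPair (hxp : H.Hxp + H.Hxpᵀ = 0) (hs : H.DynamicallyStable)
    (hgap : 0 < H.kreinGap) : ∃ x p : Momentum D → ℝ,
      GappedPair D R x p H.normHxx H.normHpp H.kreinGap ∧ ∀ k, x k / p k = H.X k / H.P k := by
  have hpos := X_mul_P_pos hxp hs hgap
  have hXc := continuous_of_mem_trigPoly H.X_mem_trigPoly
  have hle := sq_kreinGap_le hxp hs hgap
  have hX : ∀ k, |H.X k| ≤ H.normHxx := abs_symbol_le_opNorm _
  have hP : ∀ k, |H.P k| ≤ H.normHpp := abs_symbol_le_opNorm _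
  by_cases h0 : ∀ k, 0 < H.X k
  · exact ⟨H.X, H.P, ⟨H.X_mem_trigPoly, H.P_mem_trigPoly, h0,
      fun k => (pos_iff_pos_of_mul_pos (hpos k)).mp (h0 k),
      fun k => (le_abs_self _).trans (hX k), fun k => (le_abs_self _).trans (hP k), hgap, hle⟩,
      fun _ => rfl⟩
  · push Not at h0
    obtain ⟨k₀, hk₀⟩ := h0
    -- A change of sign would give a zero of `X` by the intermediate value theorem, against `X P >
    -- 0`.
    have hneg : ∀ k, H.X k < 0 := by
      intro k
      by_contra hk
      obtain ⟨k₁, hk₁⟩ := mem_range_of_exists_le_of_exists_ge hXc ⟨k₀, hk₀⟩ ⟨k, not_lt.mp hk⟩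
      have := hpos k₁
      rw [hk₁, zero_mul] at this
      exact lt_irrefl _ this
    refine ⟨-H.X, -H.P, ⟨Submodule.neg_mem _ H.X_mem_trigPoly,
      Submodule.neg_mem _ H.P_mem_trigPoly, fun k => neg_pos.mpr (hneg k),
      fun k => ?_, fun k => (neg_le_abs _).trans (hX k), fun k => (neg_le_abs _).trans (hP k),
      hgap, fun k => ?_⟩, fun k => ?_⟩
    · have h1 := hpos k
      have h2 := hneg k
      simp only [Pi.neg_apply]
      nlinarith
    · simpa using hle k
    · simp

end QBH

/-! ### Entropy of a mode and symplectic eigenvalues -/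

/-- The entropy of a mode with symplectic eigenvalue `√(1 + t)` is at most `3/2 √t`. -/
lemma modeEntropy_sqrt_le {t : ℝ} (ht : 0 ≤ t) :
    modeEntropy (Real.sqrt (1 + t)) ≤ 3 / 2 * Real.sqrt t := by
  set ν := Real.sqrt (1 + t) with hν
  have hν2 : ν ^ 2 = 1 + t := Real.sq_sqrt (by linarith)
  have hν1 : 1 ≤ ν := by rw [hν, Real.one_le_sqrt]; linarith
  set b := (ν - 1) / 2 with hb
  have hb0 : 0 ≤ b := by rw [hb]; linarith
  have ha : (ν + 1) / 2 = b + 1 := by rw [hb]; ring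
  have ht' : Real.sqrt t = 2 * Real.sqrt (b * (b + 1)) := by
    have : t = 2 ^ 2 * (b * (b + 1)) := by rw [hb]; linarith
    rw [this, Real.sqrt_mul (by norm_num), Real.sqrt_sq (by norm_num)]
  rw [modeEntropy, ha, ← hb, ht']
  rcases hb0.eq_or_lt with h0 | hpos
  · simp [← h0]
  have h1 : b ≤ Real.sqrt (b * (b + 1)) := Real.le_sqrt_of_sq_le (by nlinarith)
  have h2 : Real.log (b + 1) ≤ b := by
    have := Real.log_le_sub_one_of_pos (by linarith : 0 < b + 1)
    linarith
  -- The entropy is `log (b + 1) + b (log (b + 1) - log b)`. The second term is handled by `log q ≤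
  -- q - 1` at `q = √((b + 1) / b)`.
  have h3 : b * (Real.log (b + 1) - Real.log b) ≤ 2 * Real.sqrt (b * (b + 1)) := by
    have hq : 0 < Real.sqrt ((b + 1) / b) := Real.sqrt_pos.mpr (by positivity)
    have h4 : Real.log (b + 1) - Real.log b = 2 * Real.log (Real.sqrt ((b + 1) / b)) := by
      rw [Real.log_sqrt (by positivity), Real.log_div (by positivity) hpos.ne']
      ring
    have h5 := Real.log_le_sub_one_of_pos hq
    have h6 : b * Real.sqrt ((b + 1) / b) = Real.sqrt (b * (b + 1)) := by
      rw [show b * (b + 1) = b ^ 2 * ((b + 1) / b) by field_simp,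
        Real.sqrt_mul (by positivity), Real.sqrt_sq hb0]
    rw [h4, ← h6]
    nlinarith
  linarith

section Matrices

variable {m : Type*} [Fintype m] [DecidableEq m]

open Polynomial in
-- Block elimination: a lower triangular factor makes the characteristic matrix upper triangular,
-- and the common factor `det (X · 1)` cancels.
lemma charpoly_fromBlocks_antidiagonal {K : Type*} [Field K] (M N : Matrix m m K) :
    (Matrix.fromBlocks 0 M N 0).charpoly = (M * N).charpoly.comp (X ^ 2) := by
  have h1 : (Matrix.fromBlocks 0 M N 0).charmatrix =
      Matrix.fromBlocks (Matrix.scalar m (X : K[X])) (-M.map C) (-N.map C)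
        (Matrix.scalar m (X : K[X])) := by
    rw [Matrix.charmatrix_fromBlocks]
    simp [Matrix.charmatrix]
  have h2 : Matrix.fromBlocks (Matrix.scalar m (X : K[X])) (-M.map C) (-N.map C)
        (Matrix.scalar m (X : K[X])) *
      Matrix.fromBlocks (Matrix.scalar m (X : K[X])) 0 (N.map C) 1 =
      Matrix.fromBlocks (Matrix.scalar m (X ^ 2 : K[X]) - (M * N).map C) (-M.map C) 0
        (Matrix.scalar m (X : K[X])) := by
    rw [Matrix.fromBlocks_multiply]
    congr 1
    · rw [← map_mul, ← sq, Matrix.map_mul, sub_eq_add_neg, Matrix.neg_mul]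
    · simp
    · rw [(Matrix.scalar_commute (X : K[X]) (fun _ => Commute.all _ _) _).eq]
      simp
    · simp
  have h3 := congrArg Matrix.det h2
  rw [Matrix.det_mul, Matrix.det_fromBlocks_zero₁₂, Matrix.det_fromBlocks_zero₂₁, Matrix.det_one,
    mul_one] at h3
  have hX : (Matrix.scalar m (X : K[X])).det ≠ 0 := by
    simp [Matrix.scalar_apply, Matrix.det_diagonal]
  rw [Matrix.charpoly, h1, mul_right_cancel₀ hX h3, Matrix.charpoly]
  have h4 := RingHom.map_det (compRingHom (X ^ 2 : K[X])) (M * N).charmatrix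
  rw [coe_compRingHom_apply] at h4
  rw [h4]
  congr 1
  ext1 i j
  by_cases hij : i = j <;> simp [hij, -Matrix.map_mul]

open Polynomial in
lemma charpoly_one_add {K : Type*} [Field K] (M : Matrix m m K) :
    (1 + M).charpoly = M.charpoly.comp (X - C 1) := by
  have h4 := RingHom.map_det (compRingHom (X - C 1 : K[X])) M.charmatrix
  rw [coe_compRingHom_apply] at h4
  rw [Matrix.charpoly, Matrix.charpoly, h4]
  congr 1
  ext1 i j
  by_cases hij : i = j <;> simp [hij]
  ring

lemma roots_prod_X_sub_C_fintype {ι K : Type*} [Fintype ι] [Field K] (f : ι → K) :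
    (∏ i, (Polynomial.X - Polynomial.C (f i))).roots = Finset.univ.val.map f := by
  rw [← Polynomial.roots_multiset_prod_X_sub_C (Finset.univ.val.map f), Multiset.map_map]
  rfl

/-- The symplectic eigenvalues of `A ⊕ C` are the square roots of the eigenvalues of `C A`. -/
lemma symplecticEigenvalues_fromBlocks {A C : Matrix m m ℝ} {t : m → ℝ} (ht : ∀ i, 0 < t i)
    (h : (C * A).charpoly = ∏ i, (Polynomial.X - Polynomial.C (t i))) :
    symplecticEigenvalues (Matrix.fromBlocks A 0 0 C) =
      Finset.univ.val.map fun i => Real.sqrt (t i) := by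
  have h1 : Complex.I • (symplecticForm m * Matrix.fromBlocks A 0 0 C).map Complex.ofReal =
      Matrix.fromBlocks 0 (Complex.I • C.map Complex.ofReal)
        (-Complex.I • A.map Complex.ofReal) 0 := by
    rw [symplecticForm, Matrix.fromBlocks_multiply]
    ext i j
    rcases i with i | i <;> rcases j with j | j <;> simp
  have h2 : (Complex.I • C.map Complex.ofReal) * (-Complex.I • A.map Complex.ofReal) =
      (C * A).map Complex.ofRealHom := by
    rw [Matrix.smul_mul, Matrix.mul_smul, smul_smul, Matrix.map_mul]
    simp
    rfl
  -- `iΣ(A ⊕ C)` is block antidiagonal with product `C A`, so its spectrum is `±√t_i`; the filter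
  -- then keeps the positive half.
  have h3 : (Complex.I • (symplecticForm m * Matrix.fromBlocks A 0 0 C).map
      Complex.ofReal).charpoly = ∏ i, ((Polynomial.X - Polynomial.C ((Real.sqrt (t i) : ℝ) : ℂ)) *
        (Polynomial.X - Polynomial.C (((-Real.sqrt (t i) : ℝ) : ℂ)))) := by
    rw [h1, charpoly_fromBlocks_antidiagonal, h2, Matrix.charpoly_map, h, Polynomial.map_prod,
      Polynomial.prod_comp]
    refine Finset.prod_congr rfl fun i _ => ?_
    have h4 : ((t i : ℝ) : ℂ) = ((Real.sqrt (t i) : ℝ) : ℂ) * ((Real.sqrt (t i) : ℝ) : ℂ) := by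
      rw [← Complex.ofReal_mul, Real.mul_self_sqrt (ht i).le]
    simp only [Polynomial.map_sub, Polynomial.map_X, Polynomial.map_C, Polynomial.sub_comp,
      Polynomial.X_comp, Polynomial.C_comp, Complex.ofRealHom_eq_coe,
      Complex.ofReal_neg, Polynomial.C_neg]
    rw [h4, Polynomial.C_mul]
    ring
  rw [symplecticEigenvalues, h3, Finset.prod_mul_distrib, Polynomial.roots_mul]
  · rw [roots_prod_X_sub_C_fintype, roots_prod_X_sub_C_fintype, Multiset.map_add,
      Multiset.filter_add, Multiset.map_map, Multiset.map_map, Multiset.filter_eq_self.mpr,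
      Multiset.filter_eq_nil.mpr, add_zero]
    · rfl
    · intro x hx
      obtain ⟨i, -, rfl⟩ := Multiset.mem_map.mp hx
      simp
    · intro x hx
      obtain ⟨i, -, rfl⟩ := Multiset.mem_map.mp hx
      simpa using ht i
  · exact mul_ne_zero (Finset.prod_ne_zero_iff.mpr fun _ _ => Polynomial.X_sub_C_ne_zero _)
      (Finset.prod_ne_zero_iff.mpr fun _ _ => Polynomial.X_sub_C_ne_zero _)

/-- Peierls' inequality for the square root. -/
lemma sum_sqrt_eigenvalues_le {M : Matrix m m ℝ} (hM : M.PosSemidef) :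
    ∑ i, Real.sqrt (hM.isHermitian.eigenvalues i) ≤ ∑ i, Real.sqrt (M i i) := by
  set U : Matrix m m ℝ := (hM.isHermitian.eigenvectorUnitary : Matrix m m ℝ) with hU
  set e := hM.isHermitian.eigenvalues with he
  have hUU : U * Uᵀ = 1 := Unitary.coe_mul_star_self hM.isHermitian.eigenvectorUnitary
  have hUU' : Uᵀ * U = 1 := Unitary.coe_star_mul_self hM.isHermitian.eigenvectorUnitary
  have hrow : ∀ i, ∑ k, U i k ^ 2 = 1 := by
    intro i
    have := congrFun (congrFun hUU i) i
    rw [Matrix.mul_apply, Matrix.one_apply_eq] at this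
    simpa [sq] using this
  have hcol : ∀ k, ∑ i, U i k ^ 2 = 1 := by
    intro k
    have := congrFun (congrFun hUU' k) k
    rw [Matrix.mul_apply, Matrix.one_apply_eq] at this
    simpa [sq] using this
  have hdiag : ∀ i, M i i = ∑ k, U i k ^ 2 * e k := by
    intro i
    have h1 : M = U * Matrix.diagonal e * Uᵀ := by
      conv_lhs => rw [hM.isHermitian.spectral_theorem, Unitary.conjStarAlgAut_apply]
      rfl
    conv_lhs => rw [h1]
    rw [Matrix.mul_apply]
    refine Finset.sum_congr rfl fun k _ => ?_
    rw [Matrix.mul_diagonal, Matrix.transpose_apply]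
    ring
  calc ∑ k, Real.sqrt (e k) = ∑ k, ∑ i, U i k ^ 2 * Real.sqrt (e k) :=
        Finset.sum_congr rfl fun k _ => by rw [← Finset.sum_mul, hcol, one_mul]
    _ = ∑ i, ∑ k, U i k ^ 2 * Real.sqrt (e k) := Finset.sum_comm
    _ ≤ ∑ i, Real.sqrt (M i i) := by
      refine Finset.sum_le_sum fun i _ => ?_
      rw [hdiag i]
      -- Jensen: `M i i` averages the eigenvalues with the doubly stochastic weights `U i k ^ 2`.
      have := Real.strictConcaveOn_sqrt.concaveOn.le_map_sum (t := Finset.univ)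
        (w := fun k => U i k ^ 2) (p := e) (fun k _ => sq_nonneg _) (hrow i)
        (fun k _ => hM.eigenvalues_nonneg k)
      simpa only [smul_eq_mul] using this

/-- The spectrum of `C A`, where `C` dominates `A⁻¹`, and a bound on its distance to one. -/
lemma exists_charpoly_mul_eq {A C : Matrix m m ℝ} (hA : A.PosDef)
    (hAC : (Matrix.fromBlocks A 1 1 C).PosSemidef) {a : ℝ}
    (ha : ((a • (1 : Matrix m m ℝ)) - A).PosSemidef) {τ : m → ℝ} (hτ : ∀ i, 0 ≤ τ i)
    (hCAC : ∀ i, (C * A * C - C) i i ≤ a * τ i ^ 2) :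
    ∃ t : m → ℝ, (∀ i, 0 ≤ t i) ∧
      (C * A).charpoly = ∏ i, (Polynomial.X - Polynomial.C (1 + t i)) ∧
      ∑ i, Real.sqrt (t i) ≤ a * ∑ i, τ i := by
  have hAu : IsUnit A := hA.isUnit
  have hdet : IsUnit A.det := (Matrix.isUnit_iff_isUnit_det A).mp hAu
  let _ : Invertible A := hAu.invertible
  -- The Schur complement of `A` in the block matrix of `hAC`.
  set S := C - A⁻¹ with hS
  have hSp : S.PosSemidef := by
    have h1 : (Matrix.fromBlocks A 1 (1 : Matrix m m ℝ)ᴴ C).PosSemidef := by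
      rwa [Matrix.conjTranspose_one]
    have := (Matrix.PosDef.fromBlocks₁₁ 1 C hA).mp h1
    simpa using this
  have hSd : ∀ i, S i i ≤ a * τ i ^ 2 := by
    intro i
    refine le_trans ?_ (hCAC i)
    -- Expanding `S A S = C A C - C - S ≥ 0` bounds `S` without any inverse of `A`.
    have h1 : (Sᴴ * A * S).PosSemidef := hA.posSemidef.conjTranspose_mul_mul_same S
    have h2 : Sᴴ * A * S = C * A * C - C - S := by
      rw [hSp.isHermitian.eq, hS, Matrix.sub_mul, Matrix.nonsing_inv_mul _ hdet, Matrix.sub_mul,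
        Matrix.mul_sub, Matrix.mul_assoc C A A⁻¹, Matrix.mul_nonsing_inv _ hdet, Matrix.mul_one,
        Matrix.one_mul]
    have h3 := h1.diag_nonneg (i := i)
    rw [h2, Matrix.sub_apply] at h3
    linarith
  set W : Matrix m m ℝ := (hSp.isHermitian.eigenvectorUnitary : Matrix m m ℝ) with hW
  set s := hSp.isHermitian.eigenvalues with hs
  have hs0 : ∀ i, 0 ≤ s i := hSp.eigenvalues_nonneg
  have hWW : Wᵀ * W = 1 := Unitary.coe_star_mul_self hSp.isHermitian.eigenvectorUnitary
  set Q : Matrix m m ℝ := Matrix.diagonal fun i => Real.sqrt (s i) with hQ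
  have hQQ : Q * Q = Matrix.diagonal s := by
    rw [hQ, Matrix.diagonal_mul_diagonal]
    congr 1
    funext i
    exact Real.mul_self_sqrt (hs0 i)
  have hSW : S = W * (Q * Q) * Wᵀ := by
    conv_lhs => rw [hSp.isHermitian.spectral_theorem, Unitary.conjStarAlgAut_apply]
    rw [hQQ]
    rfl
  -- A positive semidefinite matrix with the characteristic polynomial of `S A`, so that Peierls
  -- applies. Its diagonal in the eigenbasis of `S` is at most `a s_i`.
  set T := (W * Q)ᴴ * A * (W * Q) with hT
  have hTp : T.PosSemidef := hA.posSemidef.conjTranspose_mul_mul_same _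
  have hCA : C * A = 1 + S * A := by
    rw [hS, Matrix.sub_mul, Matrix.nonsing_inv_mul _ hdet, add_sub_cancel]
  have hSA : (S * A).charpoly = T.charpoly := by
    have hQt : Qᴴ = Q := by
      rw [hQ, Matrix.diagonal_conjTranspose]
      rfl
    rw [hT, Matrix.conjTranspose_mul, hQt, Matrix.charpoly_mul_comm (Q * Wᴴ * A), hSW]
    congr 1
    simp only [Matrix.mul_assoc]
    rfl
  have hT1 : ∀ i, T i i ≤ a * s i := by
    intro i
    have h1 : ((W * Q)ᴴ * (a • (1 : Matrix m m ℝ) - A) * (W * Q)).PosSemidef :=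
      ha.conjTranspose_mul_mul_same _
    have h2 : (W * Q)ᴴ * (W * Q) = Matrix.diagonal s := by
      rw [← hQQ, Matrix.conjTranspose_mul, Matrix.mul_assoc, ← Matrix.mul_assoc Wᴴ]
      have : Wᴴ * W = 1 := hWW
      rw [this, Matrix.one_mul, hQ, Matrix.diagonal_conjTranspose]
      rfl
    have h3 : (W * Q)ᴴ * (a • (1 : Matrix m m ℝ) - A) * (W * Q) = a • Matrix.diagonal s - T := by
      rw [Matrix.mul_sub, Matrix.sub_mul, Matrix.mul_smul, Matrix.smul_mul, Matrix.mul_one, h2]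
    have h4 := h1.diag_nonneg (i := i)
    rw [h3, Matrix.sub_apply, Matrix.smul_apply, Matrix.diagonal_apply_eq, smul_eq_mul] at h4
    linarith
  refine ⟨hTp.isHermitian.eigenvalues, hTp.eigenvalues_nonneg, ?_, ?_⟩
  · rw [hCA, charpoly_one_add, hSA, hTp.isHermitian.charpoly_eq, Polynomial.prod_comp]
    refine Finset.prod_congr rfl fun i _ => ?_
    simp
    ring
  · by_cases ha0 : 0 ≤ a
    · calc ∑ i, Real.sqrt (hTp.isHermitian.eigenvalues i) ≤ ∑ i, Real.sqrt (T i i) :=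
            sum_sqrt_eigenvalues_le hTp
        _ ≤ ∑ i, Real.sqrt a * Real.sqrt (s i) := Finset.sum_le_sum fun i _ => by
            rw [← Real.sqrt_mul ha0]
            exact Real.sqrt_le_sqrt (hT1 i)
        _ = Real.sqrt a * ∑ i, Real.sqrt (s i) := by rw [Finset.mul_sum]
        _ ≤ Real.sqrt a * ∑ i, Real.sqrt (S i i) := by
            exact mul_le_mul_of_nonneg_left (sum_sqrt_eigenvalues_le hSp) (Real.sqrt_nonneg a)
        _ ≤ Real.sqrt a * ∑ i, Real.sqrt a * τ i := by
            refine mul_le_mul_of_nonneg_left (Finset.sum_le_sum fun i _ => ?_) (Real.sqrt_nonneg a)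
            have h1 := Real.sqrt_le_sqrt (hSd i)
            rwa [Real.sqrt_mul ha0, Real.sqrt_sq (hτ i)] at h1
        _ = a * ∑ i, τ i := by
            rw [← Finset.mul_sum, ← mul_assoc, Real.mul_self_sqrt ha0]
    -- `0 < A ≤ a` with `a < 0` leaves no index.
    · have hm : IsEmpty m := by
        refine ⟨fun i => ha0 ?_⟩
        have h1 := ha.diag_nonneg (i := i)
        have h2 := hA.diag_pos (i := i)
        rw [Matrix.sub_apply, Matrix.smul_apply, Matrix.one_apply_eq, smul_eq_mul, mul_one] at h1
        linarith
      simp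

/-- Entropy bound for a Gaussian state with block-diagonal covariance matrix. -/
theorem sum_modeEntropy_le {A C : Matrix m m ℝ} (hA : A.PosDef)
    (hAC : (Matrix.fromBlocks A 1 1 C).PosSemidef) {a : ℝ}
    (ha : ((a • (1 : Matrix m m ℝ)) - A).PosSemidef) {τ : m → ℝ} (hτ : ∀ i, 0 ≤ τ i)
    (hCAC : ∀ i, (C * A * C - C) i i ≤ a * τ i ^ 2) :
    ((symplecticEigenvalues (Matrix.fromBlocks A 0 0 C)).map modeEntropy).sum ≤
      3 / 2 * (a * ∑ i, τ i) := by
  obtain ⟨t, ht0, ht, hsum⟩ := exists_charpoly_mul_eq hA hAC ha hτ hCAC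
  rw [symplecticEigenvalues_fromBlocks (fun i => by linarith [ht0 i]) ht, Multiset.map_map]
  change ∑ i, modeEntropy (Real.sqrt (1 + t i)) ≤ _
  calc ∑ i, modeEntropy (Real.sqrt (1 + t i)) ≤ ∑ i, 3 / 2 * Real.sqrt (t i) :=
        Finset.sum_le_sum fun i _ => modeEntropy_sqrt_le (ht0 i)
    _ = 3 / 2 * ∑ i, Real.sqrt (t i) := by rw [Finset.mul_sum]
    _ ≤ 3 / 2 * (a * ∑ i, τ i) := by gcongr

end Matrices

/-! ### Counting boundary crossings -/

section Boundary

variable {D : ℕ}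

lemma exists_len_eq_succ {r : Site D} (hr : r ≠ 0) :
    ∃ s e : Site D, r = s + e ∧ len e = 1 ∧ len r = len s + 1 := by
  obtain ⟨μ, hμ⟩ := Function.ne_iff.mp hr
  simp only [Pi.zero_apply] at hμ
  have hsign : ((r μ).sign).natAbs = 1 := by
    rw [Int.natAbs_sign, if_neg hμ]
  refine ⟨r - Pi.single μ (r μ).sign, Pi.single μ (r μ).sign, (sub_add_cancel _ _).symm, ?_, ?_⟩
  · rw [len, Finset.sum_eq_single μ]
    · rw [Pi.single_eq_same, hsign]
    · intro ν _ hν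
      rw [Pi.single_eq_of_ne hν, Int.natAbs_zero]
    · simp
  · have hsplit : ∀ s : Site D, len s = (s μ).natAbs + ∑ ν ∈ Finset.univ.erase μ, (s ν).natAbs :=
      fun s => (Finset.add_sum_erase Finset.univ (fun ν => (s ν).natAbs) (Finset.mem_univ μ)).symm
    rw [hsplit r, hsplit]
    have h1 : ∑ ν ∈ Finset.univ.erase μ, ((r - Pi.single μ (r μ).sign : Site D) ν).natAbs =
        ∑ ν ∈ Finset.univ.erase μ, (r ν).natAbs := by
      refine Finset.sum_congr rfl fun ν hν => ?_
      rw [Pi.sub_apply, Pi.single_eq_of_ne (Finset.ne_of_mem_erase hν), sub_zero]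
    have h2 : (r μ).natAbs = ((r - Pi.single μ (r μ).sign : Site D) μ).natAbs + 1 := by
      rw [Pi.sub_apply, Pi.single_eq_same]
      rcases lt_or_gt_of_ne hμ with h | h
      · rw [Int.sign_eq_neg_one_of_neg h]; omega
      · rw [Int.sign_eq_one_of_pos h]; omega
    rw [h1, h2]
    ring

/-- `area` is an `ncard`, whose monotonicity requires a finite set. -/
lemma finite_boundary (B : Finset (Site D)) :
    {q : Site D × Site D | q.1 ∈ B ∧ q.2 ∉ B ∧ len (q.1 - q.2) = 1}.Finite := by
  refine ((B ×ˢ lenBall D 1).finite_toSet.image fun q => (q.1, q.1 - q.2)).subset ?_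
  rintro ⟨i, j⟩ ⟨hi, -, hl⟩
  refine ⟨(i, i - j), ?_, by simp⟩
  simp only [Finset.coe_product, Set.mem_prod, Finset.mem_coe, mem_lenBall]
  exact ⟨hi, hl.le⟩

/-- At most `|r| s(B)` sites of `B` leave `B` under a translation by `r`. -/
lemma card_filter_add_notMem_le (B : Finset (Site D)) (r : Site D) :
    (B.filter fun i => i + r ∉ B).card ≤ len r * area B := by
  induction h : len r generalizing r with
  | zero =>
    rw [len_eq_zero.mp h]
    simp
  | succ n ih =>
    have hr : r ≠ 0 := by rintro rfl; simp at h
    obtain ⟨s, e, rfl, he, hl⟩ := exists_len_eq_succ hr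
    have hs : len s = n := by omega
    -- A site that leaves `B` has either left it after `s` or crosses a boundary bond in the last
    -- unit step `e`.
    have hsub : (B.filter fun i => i + (s + e) ∉ B) ⊆ (B.filter fun i => i + s ∉ B) ∪
        B.filter fun i => i + s ∈ B ∧ i + (s + e) ∉ B := by
      intro i hi
      simp only [Finset.mem_union, Finset.mem_filter] at hi ⊢
      tauto
    have hcross : (B.filter fun i => i + s ∈ B ∧ i + (s + e) ∉ B).card ≤ area B := by
      rw [← Set.ncard_coe_finset, area]
      refine Set.ncard_le_ncard_of_injOn (fun i => (i + s, i + (s + e))) ?_ ?_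
        (finite_boundary B)
      · intro i hi
        simp only [Finset.coe_filter, Set.mem_ofPred_eq] at hi
        refine ⟨hi.2.1, hi.2.2, ?_⟩
        rw [show i + s - (i + (s + e)) = -e by abel, len_neg, he]
      · intro i _ j _ hij
        exact add_right_cancel (Prod.ext_iff.mp hij).1
    calc _ ≤ _ := Finset.card_le_card hsub
      _ ≤ _ := Finset.card_union_le _ _
      _ ≤ n * area B + area B := add_le_add (ih s hs) hcross
      _ = (n + 1) * area B := by ring

/-- The number of displacements of given length. -/
lemma card_len_eq_le (d n N : ℕ) :
    ((lenBall (d + 1) N).filter fun r => len r = n).card ≤ 2 * (2 * n + 1) ^ d := by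
  have hbox : (box d n).card = (2 * n + 1) ^ d := by
    rw [box, Pi.card_Icc]
    simp only [Int.card_Icc, Finset.prod_const, Finset.card_univ, Fintype.card_fin]
    congr 1
    omega
  have hcard : ((Finset.univ : Finset Bool) ×ˢ box d n).card = 2 * (2 * n + 1) ^ d := by
    rw [Finset.card_product, hbox]
    rfl
  rw [← hcard]
  have hlen : ∀ r : Site (d + 1), len r = (r 0).natAbs + len (Fin.tail r) := fun r =>
    Fin.sum_univ_succ _
  -- Given the length, the tail determines `|r 0|`, so only the sign of `r 0` is left.
  refine Finset.card_le_card_of_injOn (fun r => (decide (0 ≤ r 0), Fin.tail r)) ?_ ?_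
  · intro r hr
    have hr' := (Finset.mem_filter.mp hr).2
    have h1 := hlen r
    have h2 : len (Fin.tail r) ≤ n := by omega
    exact Finset.mem_product.mpr ⟨Finset.mem_univ _, mem_box_of_len_le h2⟩
  · intro r hr s hs hrs
    have hr' := (Finset.mem_filter.mp hr).2
    have hs' := (Finset.mem_filter.mp hs).2
    obtain ⟨h1, h2⟩ := Prod.ext_iff.mp hrs
    simp only [decide_eq_decide] at h1 h2
    have h3 := hlen r
    have h4 := hlen s
    rw [h2] at h3
    have h0 : r 0 = s 0 := by omega
    rw [← Fin.cons_self_tail r, ← Fin.cons_self_tail s, h0, h2]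

lemma polylog_eq (d : ℕ) (w : ℝ) : polylog (1 - 2 * ((d + 1 : ℕ) : ℤ)) w =
    ∑' n : ℕ, w ^ (n + 1) * ((n : ℝ) + 1) ^ (2 * d + 1) := by
  unfold polylog
  refine tsum_congr fun n => ?_
  have : (1 - 2 * ((d + 1 : ℕ) : ℤ)) = -((2 * d + 1 : ℕ) : ℤ) := by push_cast; ring
  rw [this, zpow_neg, zpow_natCast, div_inv_eq_mul]

lemma summable_polylog (d : ℕ) {w : ℝ} (h0 : 0 ≤ w) (h1 : w < 1) :
    Summable fun n : ℕ => w ^ (n + 1) * ((n : ℝ) + 1) ^ (2 * d + 1) := by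
  have h := summable_pow_mul_geometric_of_norm_lt_one (2 * d + 1) (r := w)
    (by rwa [Real.norm_eq_abs, abs_of_nonneg h0])
  refine ((summable_nat_add_iff 1).mpr h).congr fun n => ?_
  push_cast
  ring

/-- Sums of exponentially decaying terms across the boundary of `B`. -/
theorem sum_pow_len_le {d : ℕ} (B F : Finset (Site (d + 1))) {w : ℝ} (h0 : 0 ≤ w) (h1 : w < 1) :
    ∑ i ∈ B, ∑ j ∈ F \ B, w ^ len (i - j) ≤
      2 * 3 ^ d * (area B : ℝ) * polylog (1 - 2 * ((d + 1 : ℕ) : ℤ)) w := by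
  set N := (B ×ˢ F).sup fun q => len (q.1 - q.2) with hN
  have hinner : ∀ i ∈ B, ∑ j ∈ F \ B, w ^ len (i - j) ≤
      ∑ r ∈ lenBall (d + 1) N, if i + r ∉ B then w ^ len r else 0 := by
    intro i hi
    rw [← Finset.sum_filter]
    have hinj : Set.InjOn (fun j => j - i) (F \ B : Finset (Site (d + 1))) :=
      fun j _ k _ h => sub_left_injective h
    calc ∑ j ∈ F \ B, w ^ len (i - j) = ∑ r ∈ (F \ B).image fun j => j - i, w ^ len r := by
          rw [Finset.sum_image hinj]
          exact Finset.sum_congr rfl fun j _ => by rw [len_sub_comm]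
      _ ≤ _ := by
        refine Finset.sum_le_sum_of_subset_of_nonneg ?_ fun _ _ _ => by positivity
        intro r hr
        obtain ⟨j, hj, rfl⟩ := Finset.mem_image.mp hr
        rw [Finset.mem_sdiff] at hj
        rw [Finset.mem_filter, mem_lenBall, add_sub_cancel]
        refine ⟨?_, hj.2⟩
        rw [len_sub_comm]
        exact Finset.le_sup (f := fun q : Site (d + 1) × Site (d + 1) => len (q.1 - q.2))
          (Finset.mem_product.mpr ⟨hi, hj.1⟩ : (i, j) ∈ B ×ˢ F)
  have hcount : ∀ r : Site (d + 1), ∑ i ∈ B, (if i + r ∉ B then w ^ len r else 0) ≤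
      (area B : ℝ) * (len r * w ^ len r) := by
    intro r
    rw [← Finset.sum_filter, Finset.sum_const, nsmul_eq_mul]
    have : ((B.filter fun i => i + r ∉ B).card : ℝ) ≤ len r * area B := by
      exact_mod_cast card_filter_add_notMem_le B r
    calc _ ≤ (len r * area B : ℝ) * w ^ len r := by gcongr
      _ = _ := by ring
  have hfib : ∑ r ∈ lenBall (d + 1) N, (len r : ℝ) * w ^ len r =
      ∑ n ∈ Finset.range (N + 1), ((lenBall (d + 1) N).filter fun r => len r = n).card *
        ((n : ℝ) * w ^ n) := by
    rw [← Finset.sum_fiberwise_of_maps_to (g := len) (t := Finset.range (N + 1))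
      (fun r hr => Finset.mem_range.mpr (Nat.lt_succ_of_le (mem_lenBall.mp hr)))]
    refine Finset.sum_congr rfl fun n _ => ?_
    rw [← nsmul_eq_mul, ← Finset.sum_const]
    refine Finset.sum_congr rfl fun r hr => ?_
    rw [(Finset.mem_filter.mp hr).2]
  have hterm : ∀ n : ℕ, (((lenBall (d + 1) N).filter fun r => len r = n + 1).card : ℝ) *
      (((n + 1 : ℕ) : ℝ) * w ^ (n + 1)) ≤
        2 * 3 ^ d * (w ^ (n + 1) * ((n : ℝ) + 1) ^ (2 * d + 1)) := by
    intro n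
    have h2 : (((lenBall (d + 1) N).filter fun r => len r = n + 1).card : ℝ) ≤
        2 * (2 * ((n : ℝ) + 1) + 1) ^ d := by
      exact_mod_cast card_len_eq_le d (n + 1) N
    -- Exponent `d` would do; `2 * d` is taken to match the order `1 - 2D` of the polylogarithm.
    have h3 : (2 * ((n : ℝ) + 1) + 1) ^ d ≤ 3 ^ d * ((n : ℝ) + 1) ^ (2 * d) := by
      calc (2 * ((n : ℝ) + 1) + 1) ^ d ≤ (3 * ((n : ℝ) + 1)) ^ d := by
            gcongr
            linarith [(Nat.cast_nonneg n : (0 : ℝ) ≤ n)]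
        _ = 3 ^ d * ((n : ℝ) + 1) ^ d := mul_pow _ _ _
        _ ≤ 3 ^ d * ((n : ℝ) + 1) ^ (2 * d) := by
            gcongr
            · linarith [(Nat.cast_nonneg n : (0 : ℝ) ≤ n)]
            · omega
    push_cast
    calc _ ≤ (2 * (3 ^ d * ((n : ℝ) + 1) ^ (2 * d))) * (((n : ℝ) + 1) * w ^ (n + 1)) := by
          gcongr
          exact h2.trans (by gcongr)
      _ = _ := by ring
  have hsum := summable_polylog d h0 h1
  calc ∑ i ∈ B, ∑ j ∈ F \ B, w ^ len (i - j)
      ≤ ∑ i ∈ B, ∑ r ∈ lenBall (d + 1) N, (if i + r ∉ B then w ^ len r else 0) :=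
        Finset.sum_le_sum hinner
    _ = ∑ r ∈ lenBall (d + 1) N, ∑ i ∈ B, (if i + r ∉ B then w ^ len r else 0) :=
        Finset.sum_comm
    _ ≤ ∑ r ∈ lenBall (d + 1) N, (area B : ℝ) * (len r * w ^ len r) :=
        Finset.sum_le_sum fun r _ => hcount r
    _ = (area B : ℝ) * ∑ n ∈ Finset.range N,
        (((lenBall (d + 1) N).filter fun r => len r = n + 1).card : ℝ) *
          (((n + 1 : ℕ) : ℝ) * w ^ (n + 1)) := by
        rw [← Finset.mul_sum, hfib, Finset.sum_range_succ']
        simp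
    _ ≤ (area B : ℝ) * ∑ n ∈ Finset.range N,
        2 * 3 ^ d * (w ^ (n + 1) * ((n : ℝ) + 1) ^ (2 * d + 1)) := by
        exact mul_le_mul_of_nonneg_left (Finset.sum_le_sum fun n _ => hterm n) (Nat.cast_nonneg _)
    _ ≤ (area B : ℝ) * (2 * 3 ^ d * polylog (1 - 2 * ((d + 1 : ℕ) : ℤ)) w) := by
        rw [← Finset.mul_sum, polylog_eq]
        gcongr
        exact hsum.sum_le_tsum _ fun n _ => by positivity
    _ = _ := by ring

end Boundary

/-! ### Quadratic forms of lattice Fourier coefficients -/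

section QuadraticForms

variable {D : ℕ} {B : Finset (Site D)}

/-- The cosine sum with coefficients `y`. -/
def cosSum (y : B → ℝ) (k : Momentum D) : ℝ := ∑ i, y i * Real.cos (dotK k i)

/-- The sine sum with coefficients `y`. -/
def sinSum (y : B → ℝ) (k : Momentum D) : ℝ := ∑ i, y i * Real.sin (dotK k i)

@[fun_prop] lemma continuous_cosSum (y : B → ℝ) : Continuous (cosSum y) := by
  unfold cosSum; fun_prop

@[fun_prop] lemma continuous_sinSum (y : B → ℝ) : Continuous (sinSum y) := by
  unfold sinSum; fun_prop

/-- The compression to `B` of the lattice operator with symbol `f`. -/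
def coeffMatrix (f : Momentum D → ℝ) (B : Finset (Site D)) : Matrix B B ℝ :=
  Matrix.of fun i j => coeff f ((i : Site D) - j)

lemma isHermitian_coeffMatrix (f : Momentum D → ℝ) : (coeffMatrix f B).IsHermitian := by
  ext i j
  simp [coeffMatrix, coeff_sub_comm f (j : Site D)]

/-- Plancherel in real form: the cosine and sine sums are the real and imaginary parts of the
Fourier transform of a vector supported on `B`. -/
lemma dotProduct_coeffMatrix {f : Momentum D → ℝ} (hf : Continuous f) (y z : B → ℝ) :
    y ⬝ᵥ (coeffMatrix f B *ᵥ z) =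
      mean fun k => f k * (cosSum y k * cosSum z k + sinSum y k * sinSum z k) := by
  have h1 : ∀ k, f k * (cosSum y k * cosSum z k + sinSum y k * sinSum z k) =
      ∑ i, ∑ j, (y i * z j) * (Real.cos (dotK k ((i : Site D) - j)) * f k) := by
    intro k
    simp only [cosSum, sinSum, Finset.sum_mul_sum, dotK_sub, Real.cos_sub]
    rw [← Finset.sum_add_distrib, Finset.mul_sum]
    refine Finset.sum_congr rfl fun i _ => ?_
    rw [← Finset.sum_add_distrib, Finset.mul_sum]
    exact Finset.sum_congr rfl fun j _ => by ring
  simp only [h1]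
  rw [mean_sum _ fun i _ => by fun_prop]
  simp only [dotProduct, Matrix.mulVec, Finset.mul_sum]
  refine Finset.sum_congr rfl fun i _ => ?_
  rw [mean_sum _ fun j _ => by fun_prop]
  refine Finset.sum_congr rfl fun j _ => ?_
  rw [mean_const_mul, coeffMatrix, Matrix.of_apply, coeff]
  ring

lemma coeffMatrix_one : coeffMatrix (fun _ => 1) B = 1 := by
  ext i j
  simp only [coeffMatrix, Matrix.of_apply, coeff, mul_one, mean_cos, sub_eq_zero,
    Matrix.one_apply, Subtype.ext_iff]

lemma mean_cosSum_mul_add (y z : B → ℝ) :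
    mean (fun k => cosSum y k * cosSum z k + sinSum y k * sinSum z k) = y ⬝ᵥ z := by
  have := dotProduct_coeffMatrix (f := fun _ => 1) continuous_const y z
  simpa [coeffMatrix_one] using this.symm

lemma posSemidef_coeffMatrix_sub {f : Momentum D → ℝ} (hf : Continuous f) {α : ℝ}
    (h : ∀ k, f k ≤ α) : (α • (1 : Matrix B B ℝ) - coeffMatrix f B).PosSemidef := by
  refine Matrix.PosSemidef.of_dotProduct_mulVec_nonneg ?_ fun y => ?_
  · exact (Matrix.isHermitian_one.smul (IsSelfAdjoint.all α)).sub (isHermitian_coeffMatrix f)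
  · rw [star_trivial, Matrix.sub_mulVec, dotProduct_sub, dotProduct_coeffMatrix hf,
      Matrix.smul_mulVec, Matrix.one_mulVec, dotProduct_smul, ← mean_cosSum_mul_add, smul_eq_mul,
      ← mean_const_mul, ← mean_sub (by fun_prop) (by fun_prop)]
    refine mean_nonneg fun k => ?_
    rw [← sub_mul]
    exact mul_nonneg (sub_nonneg.mpr (h k))
      (add_nonneg (mul_self_nonneg _) (mul_self_nonneg _))

lemma posDef_coeffMatrix {f : Momentum D → ℝ} (hf : Continuous f) {β : ℝ} (hβ : 0 < β)
    (h : ∀ k, β ≤ f k) : (coeffMatrix f B).PosDef := by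
  refine Matrix.PosDef.of_dotProduct_mulVec_pos (isHermitian_coeffMatrix f) fun y hy => ?_
  rw [star_trivial, dotProduct_coeffMatrix hf]
  have h1 : 0 < y ⬝ᵥ y := by
    have := Matrix.dotProduct_star_self_pos_iff.mpr hy
    rwa [star_trivial] at this
  calc 0 < β * (y ⬝ᵥ y) := by positivity
    _ = mean fun k => β * (cosSum y k * cosSum y k + sinSum y k * sinSum y k) := by
      rw [mean_const_mul, mean_cosSum_mul_add]
    _ ≤ _ := mean_mono (by fun_prop) (by fun_prop) fun k =>
      mul_le_mul_of_nonneg_right (h k) (add_nonneg (mul_self_nonneg _) (mul_self_nonneg _))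

/-- At each momentum `u v = 1` completes the square: with hats for Fourier transforms, the form is
`u |ŷ₁ + v ŷ₂|²`. -/
lemma posSemidef_fromBlocks_coeffMatrix {u v : Momentum D → ℝ} (hu : Continuous u)
    (hv : Continuous v) (hu0 : ∀ k, 0 ≤ u k) (huv : ∀ k, u k * v k = 1) :
    (Matrix.fromBlocks (coeffMatrix u B) 1 1 (coeffMatrix v B)).PosSemidef := by
  refine Matrix.PosSemidef.of_dotProduct_mulVec_nonneg ?_ fun y => ?_
  · rw [Matrix.isHermitian_fromBlocks_iff]
    exact ⟨isHermitian_coeffMatrix u, Matrix.conjTranspose_one, Matrix.conjTranspose_one,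
      isHermitian_coeffMatrix v⟩
  · obtain ⟨y₁, y₂, rfl⟩ : ∃ y₁ y₂ : B → ℝ, y = Sum.elim y₁ y₂ :=
      ⟨y ∘ Sum.inl, y ∘ Sum.inr, (Sum.elim_comp_inl_inr y).symm⟩
    have h1 : Sum.elim y₁ y₂ ⬝ᵥ
        (Matrix.fromBlocks (coeffMatrix u B) 1 1 (coeffMatrix v B) *ᵥ Sum.elim y₁ y₂) =
        y₁ ⬝ᵥ (coeffMatrix u B *ᵥ y₁) + 2 * (y₁ ⬝ᵥ y₂) + y₂ ⬝ᵥ (coeffMatrix v B *ᵥ y₂) := by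
      rw [Matrix.fromBlocks_mulVec, sumElim_dotProduct_sumElim]
      simp only [Sum.elim_comp_inl, Sum.elim_comp_inr, Matrix.one_mulVec, dotProduct_add]
      rw [dotProduct_comm y₂ y₁]
      ring
    rw [star_trivial, h1, dotProduct_coeffMatrix hu, dotProduct_coeffMatrix hv,
      ← mean_cosSum_mul_add, ← mean_const_mul, ← mean_add (by fun_prop) (by fun_prop),
      ← mean_add (by fun_prop) (by fun_prop)]
    refine mean_nonneg fun k => ?_
    have h2 : u k * (cosSum y₁ k * cosSum y₁ k + sinSum y₁ k * sinSum y₁ k) +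
        2 * (cosSum y₁ k * cosSum y₂ k + sinSum y₁ k * sinSum y₂ k) +
        v k * (cosSum y₂ k * cosSum y₂ k + sinSum y₂ k * sinSum y₂ k) =
        u k * ((cosSum y₁ k + v k * cosSum y₂ k) ^ 2 +
          (sinSum y₁ k + v k * sinSum y₂ k) ^ 2) := by
      linear_combination (-2 * (cosSum y₁ k * cosSum y₂ k + sinSum y₁ k * sinSum y₂ k) -
        v k * (cosSum y₂ k * cosSum y₂ k + sinSum y₂ k * sinSum y₂ k)) * huv k
    rw [h2]
    exact mul_nonneg (hu0 k) (by positivity)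

/-- Let `y` be column `i` of the compression of `v`. Since `u v = 1`, the entry on the left is the
`u`-weighted square norm of `v e_i - y`, the part of `v e_i` outside `B`; the bracket on the right
is its plain square norm. -/
lemma coeffMatrix_mul_mul_sub_le {u v : Momentum D → ℝ} (hu : Continuous u)
    (hv : Continuous v) {α : ℝ} (hα : ∀ k, u k ≤ α) (huv : ∀ k, u k * v k = 1) (i : B) :
    (coeffMatrix v B * coeffMatrix u B * coeffMatrix v B - coeffMatrix v B) i i ≤
      α * (mean (fun k => v k ^ 2) - ∑ l : B, coeff v ((i : Site D) - l) ^ 2) := by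
  set e : B → ℝ := Pi.single i 1 with he
  set y : B → ℝ := fun l => coeffMatrix v B l i with hy
  have hyC : y = coeffMatrix v B *ᵥ e := by
    rw [he, Matrix.mulVec_single_one]
    rfl
  have hyi : ∀ l : B, y l = coeff v ((i : Site D) - l) := fun l => coeff_sub_comm v _ _
  have hee : ∀ k, cosSum e k * cosSum e k + sinSum e k * sinSum e k = 1 := by
    intro k
    have h1 : cosSum e k = Real.cos (dotK k i) := by simp [cosSum, he, Pi.single_apply]
    have h2 : sinSum e k = Real.sin (dotK k i) := by simp [sinSum, he, Pi.single_apply]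
    rw [h1, h2]
    linear_combination Real.sin_sq_add_cos_sq (dotK k i)
  let q : Momentum D → ℝ := fun k =>
    (v k * cosSum e k - cosSum y k) ^ 2 + (v k * sinSum e k - sinSum y k) ^ 2
  have hq : Continuous q := by fun_prop
  have h1 : (coeffMatrix v B * coeffMatrix u B * coeffMatrix v B - coeffMatrix v B) i i =
      mean fun k => u k * q k := by
    have e1 : (fun k => u k * q k) = fun k =>
        v k * (cosSum e k * cosSum e k + sinSum e k * sinSum e k) -
          2 * (cosSum e k * cosSum y k + sinSum e k * sinSum y k) +
          u k * (cosSum y k * cosSum y k + sinSum y k * sinSum y k) := by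
      funext k
      simp only [q]
      linear_combination (v k * (cosSum e k * cosSum e k + sinSum e k * sinSum e k) -
          2 * (cosSum e k * cosSum y k + sinSum e k * sinSum y k)) * huv k
    rw [e1, mean_add (by fun_prop) (by fun_prop), mean_sub (by fun_prop) (by fun_prop),
      mean_const_mul, mean_cosSum_mul_add, ← dotProduct_coeffMatrix hv,
      ← dotProduct_coeffMatrix hu, ← hyC]
    have e2 : e ⬝ᵥ y = coeffMatrix v B i i := by
      rw [he, single_one_dotProduct]
    have e3 : (coeffMatrix v B * coeffMatrix u B * coeffMatrix v B) i i =
        y ⬝ᵥ (coeffMatrix u B *ᵥ y) := by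
      rw [Matrix.mul_assoc, Matrix.mul_apply]
      refine Finset.sum_congr rfl fun l _ => ?_
      have : coeffMatrix v B i l = y l := (hyi l).symm
      rw [this]
      rfl
    rw [e2, Matrix.sub_apply, e3]
    ring
  have h2 : mean q = mean (fun k => v k ^ 2) - ∑ l : B, coeff v ((i : Site D) - l) ^ 2 := by
    have e1 : q = fun k => v k ^ 2 -
          2 * (v k * (cosSum y k * cosSum e k + sinSum y k * sinSum e k)) +
          (cosSum y k * cosSum y k + sinSum y k * sinSum y k) := by
      funext k
      simp only [q]
      linear_combination v k ^ 2 * hee k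
    rw [e1, mean_add (by fun_prop) (by fun_prop), mean_sub (by fun_prop) (by fun_prop),
      mean_const_mul, mean_cosSum_mul_add, ← dotProduct_coeffMatrix hv, ← hyC]
    have e2 : y ⬝ᵥ y = ∑ l : B, coeff v ((i : Site D) - l) ^ 2 :=
      Finset.sum_congr rfl fun l _ => by rw [← hyi, sq]
    rw [e2]
    ring
  rw [h1, ← h2, ← mean_const_mul]
  refine mean_mono (by fun_prop) (by fun_prop) fun k => ?_
  exact mul_le_mul_of_nonneg_right (hα k) (by positivity)

end QuadraticForms

/-! ### The area law for a gapped pair -/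

namespace GappedPair

variable {d R : ℕ} {x p : Momentum (d + 1) → ℝ} {a b E : ℝ}

lemma sqrt_mul_sqrt (h : GappedPair (d + 1) R x p a b E) (k : Momentum (d + 1)) :
    Real.sqrt (p k / x k) * Real.sqrt (x k / p k) = 1 := by
  have hx := h.pos_left k
  have hp := h.pos_right k
  rw [← Real.sqrt_mul (by positivity)]
  field_simp
  simp

/-- The area law for the Gaussian state with symbols `√(p / x)` and `√(x / p)`. -/
theorem entropy_le (h : GappedPair (d + 1) R x p a b E) (B : Finset (Site (d + 1)))
    {κ w : ℝ} (hw0 : 0 ≤ w) (hw1 : w < 1)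
    (hκ : ∀ r, |coeff (fun k => Real.sqrt (x k / p k)) r| ≤ κ * w ^ len r) :
    ((symplecticEigenvalues (Matrix.fromBlocks
      (coeffMatrix (fun k => Real.sqrt (p k / x k)) B) 0 0
      (coeffMatrix (fun k => Real.sqrt (x k / p k)) B))).map modeEntropy).sum ≤
      3 / 2 * (2 * b / E * (κ * (2 * 3 ^ d * (area B : ℝ) *
        polylog (1 - 2 * ((d + 1 : ℕ) : ℤ)) w))) := by
  set v : Momentum (d + 1) → ℝ := fun k => Real.sqrt (x k / p k) with hv
  set u : Momentum (d + 1) → ℝ := fun k => Real.sqrt (p k / x k) with hu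
  have hvc : Continuous v := h.continuous_sqrt_div
  have huc : Continuous u := h.symm.continuous_sqrt_div
  have huv : ∀ k, u k * v k = 1 := h.sqrt_mul_sqrt
  have hE := h.gap_pos
  have ha := h.left_pos
  have hb := h.symm.left_pos
  have hα : ∀ k, u k ≤ 2 * b / E := h.symm.sqrt_div_le
  have hβ : ∀ k, E / (2 * a) ≤ u k := by
    intro k
    have h1 := h.sqrt_div_le k
    have h2 := huv k
    have h3 : 0 ≤ u k := Real.sqrt_nonneg _
    rw [div_le_iff₀ (by positivity)]
    rw [le_div_iff₀ hE] at h1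
    nlinarith
  have hκ0 : 0 ≤ κ := by
    have := (abs_nonneg _).trans (hκ 0)
    simpa using this
  -- Parseval enters only up to `ε`, through a trigonometric approximation of `v`. All sums stay
  -- finite, and `ε → 0` at the end.
  have key : ∀ ε > 0, ((symplecticEigenvalues (Matrix.fromBlocks
      (coeffMatrix u B) 0 0 (coeffMatrix v B))).map modeEntropy).sum ≤
      3 / 2 * (2 * b / E * (κ * (2 * 3 ^ d * (area B : ℝ) *
        polylog (1 - 2 * ((d + 1 : ℕ) : ℤ)) w) + B.card * ε)) := by
    intro ε hε
    obtain ⟨N, f, hf, hfa⟩ := h.exists_approx_of_pos hε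
    have hfc := continuous_of_mem_trigPoly hf
    have hms : mean (fun k => v k ^ 2) ≤ ∑ r ∈ lenBall (d + 1) N, coeff v r ^ 2 + ε ^ 2 := by
      refine (mean_sq_le hvc hf).trans ?_
      gcongr
      rw [← mean_const (D := d + 1) (ε ^ 2)]
      refine mean_mono (by fun_prop) (by fun_prop) fun k => ?_
      rw [← sq_abs]
      exact pow_le_pow_left₀ (abs_nonneg _) (hfa k) 2
    -- `F` contains the `N`-ball around each site of `B`, so `F \ B` carries all of the exterior
    -- weight up to `ε²`.
    set F := B.biUnion fun i => (lenBall (d + 1) N).image fun r => i + r with hF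
    have hBF : B ⊆ F := fun i hi => Finset.mem_biUnion.mpr ⟨i, hi,
      Finset.mem_image.mpr ⟨0, by simp, add_zero i⟩⟩
    set τ : B → ℝ := fun i => ∑ j ∈ F \ B, |coeff v ((i : Site (d + 1)) - j)| + ε with hτ
    have hτ0 : ∀ i, 0 ≤ τ i := fun i =>
      add_nonneg (Finset.sum_nonneg fun _ _ => abs_nonneg _) hε.le
    have hball : ∀ i : B, ∑ r ∈ lenBall (d + 1) N, coeff v r ^ 2 ≤
        ∑ j ∈ F, coeff v ((i : Site (d + 1)) - j) ^ 2 := by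
      intro i
      calc ∑ r ∈ lenBall (d + 1) N, coeff v r ^ 2
          = ∑ j ∈ (lenBall (d + 1) N).image fun r => (i : Site (d + 1)) + r,
            coeff v ((i : Site (d + 1)) - j) ^ 2 := by
            rw [Finset.sum_image fun r _ s _ hrs => add_left_cancel hrs]
            refine Finset.sum_congr rfl fun r _ => ?_
            rw [sub_add_cancel_left, coeff_neg_site]
        _ ≤ _ := Finset.sum_le_sum_of_subset_of_nonneg
            (Finset.subset_biUnion_of_mem
              (fun i : Site (d + 1) => (lenBall (d + 1) N).image fun r => i + r) i.2)
            fun _ _ _ => sq_nonneg _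
    have hCAC : ∀ i, (coeffMatrix v B * coeffMatrix u B * coeffMatrix v B - coeffMatrix v B) i i ≤
        2 * b / E * τ i ^ 2 := by
      intro i
      refine (coeffMatrix_mul_mul_sub_le huc hvc hα huv i).trans ?_
      gcongr
      have h1 : ∑ l : B, coeff v ((i : Site (d + 1)) - l) ^ 2 =
          ∑ l ∈ B, coeff v ((i : Site (d + 1)) - l) ^ 2 :=
        Finset.sum_coe_sort B fun l => coeff v ((i : Site (d + 1)) - l) ^ 2
      have h2 := Finset.sum_sdiff (f := fun j => coeff v ((i : Site (d + 1)) - j) ^ 2) hBF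
      -- The `ℓ²` norm is at most the `ℓ¹` norm, which makes the row bounds additive in the boundary
      -- sum.
      have h3 : ∑ j ∈ F \ B, coeff v ((i : Site (d + 1)) - j) ^ 2 ≤
          (∑ j ∈ F \ B, |coeff v ((i : Site (d + 1)) - j)|) ^ 2 := by
        simp only [← sq_abs (coeff v _)]
        exact Finset.sum_sq_le_sq_sum_of_nonneg fun _ _ => abs_nonneg _
      have h4 : 0 ≤ ∑ j ∈ F \ B, |coeff v ((i : Site (d + 1)) - j)| :=
        Finset.sum_nonneg fun _ _ => abs_nonneg _
      have h5 := hball i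
      have h6 := mul_nonneg h4 hε.le
      simp only [hτ]
      nlinarith
    refine (sum_modeEntropy_le (posDef_coeffMatrix huc (by positivity) hβ)
      (posSemidef_fromBlocks_coeffMatrix huc hvc (fun k => Real.sqrt_nonneg _) huv)
      (posSemidef_coeffMatrix_sub huc hα) hτ0 hCAC).trans ?_
    have hsum : ∑ i, τ i ≤ κ * (2 * 3 ^ d * (area B : ℝ) *
        polylog (1 - 2 * ((d + 1 : ℕ) : ℤ)) w) + B.card * ε := by
      simp only [hτ]
      rw [Finset.sum_add_distrib, Finset.sum_const, nsmul_eq_mul, Finset.card_univ,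
        Fintype.card_coe]
      gcongr
      rw [Finset.sum_coe_sort B fun i => ∑ j ∈ F \ B, |coeff v (i - j)|]
      calc ∑ i ∈ B, ∑ j ∈ F \ B, |coeff v (i - j)|
          ≤ ∑ i ∈ B, ∑ j ∈ F \ B, κ * w ^ len (i - j) :=
            Finset.sum_le_sum fun i _ => Finset.sum_le_sum fun j _ => hκ _
        _ = κ * ∑ i ∈ B, ∑ j ∈ F \ B, w ^ len (i - j) := by simp only [Finset.mul_sum]
        _ ≤ _ := by
          gcongr
          exact sum_pow_len_le B F hw0 hw1
    gcongr
  set t := κ * (2 * 3 ^ d * (area B : ℝ) * polylog (1 - 2 * ((d + 1 : ℕ) : ℤ)) w)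
  have hlim : Filter.Tendsto (fun ε : ℝ => 3 / 2 * (2 * b / E * (t + B.card * ε)))
      (nhdsWithin 0 (Set.Ioi 0)) (nhds (3 / 2 * (2 * b / E * (t + B.card * 0)))) :=
    (Continuous.tendsto (by fun_prop) 0).mono_left nhdsWithin_le_nhds
  rw [mul_zero, add_zero] at hlim
  exact ge_of_tendsto hlim (Filter.eventually_of_mem self_mem_nhdsWithin fun ε hε => key ε hε)

end GappedPair

lemma fourierBlock_zero {D : ℕ} : fourierBlock (fun _ : Momentum D => (0 : ℂ)) = 0 := by
  ext j j'
  simp [fourierBlock]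

/-- The covariance matrix of the harmonic lattice in terms of real Fourier coefficients. -/
lemma GappedPair.harmonicΓ_eq {D R : ℕ} {x p V : Momentum D → ℝ} {a b E : ℝ}
    (h : GappedPair D R x p a b E) (hV : ∀ k, x k / p k = V k) :
    harmonicΓ V = Matrix.fromBlocks
      (Matrix.of fun j j' => coeff (fun k => Real.sqrt (p k / x k)) (j - j')) 0 0
      (Matrix.of fun j j' => coeff (fun k => Real.sqrt (x k / p k)) (j - j')) := by
  have h1 : ∀ k, V k ^ (1 / 2 : ℝ) = Real.sqrt (x k / p k) := fun k => by
    rw [← hV, Real.sqrt_eq_rpow]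
  have h2 : ∀ k, V k ^ (-(1 / 2) : ℝ) = Real.sqrt (p k / x k) := fun k => by
    have hx := h.pos_left k
    have hp := h.pos_right k
    rw [Real.rpow_neg (by rw [← hV]; positivity), h1, ← Real.sqrt_inv, inv_div]
  have h3 : ∀ (f : Momentum D → ℝ), Continuous f → fourierBlock (fun k => (f k : ℂ)) =
      Matrix.of fun j j' => coeff f (j - j') := fun f hf => by
    ext j j'
    exact fourierBlock_ofReal hf j j'
  rw [harmonicΓ, realSpaceCov]
  simp only [Matrix.of_apply, Matrix.cons_val', Matrix.cons_val_zero, Matrix.cons_val_one,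
    Matrix.cons_val_fin_one, fourierBlock_zero, h1, h2]
  rw [h3 _ h.continuous_sqrt_div, h3 _ h.symm.continuous_sqrt_div]

end Krein

end

/-! ### Assembly of the three claims -/

theorem mainTheorem7 (D : ℕ) (hD : 1 ≤ D) :
    ∃ c : ℝ, 0 < c ∧ ∀ (R : ℕ) (H : Krein.QBH D R), 1 ≤ R →
      H.DynamicallyStable → 0 < H.kreinGap → H.Hxp + H.Hxpᵀ = 0 →
      (∀ k, H.X k ≠ 0 ∧ H.P k ≠ 0 ∧ 0 < H.X k / H.P k) ∧
      Nonempty H.Bogoliubov ∧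
      ∀ Q : H.Bogoliubov,
        Q.Γ = Krein.harmonicΓ (fun k => H.X k / H.P k) ∧
        Krein.IsCorrelationLength Q c
          (c * R * Real.sqrt (H.normHxx * H.normHpp) / H.kreinGap) ∧
        ∀ ξ : ℝ, Krein.IsCorrelationLength Q c ξ → ∀ B : Finset (Krein.Site D),
          Krein.entanglementEntropy Q.Γ B ≤
            16 * c ^ 2 * (H.normHxx * H.normHpp) *
              Krein.polylog (1 - 2 * (D : ℤ)) (Real.exp (-1 / ξ)) *
              (Krein.area B : ℝ) / H.kreinGap ^ 2 := by
  obtain ⟨d, rfl⟩ := Nat.exists_eq_add_of_le' hD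
  have h3d : (1 : ℝ) ≤ 3 ^ d := one_le_pow₀ (by norm_num)
  -- `16` is required by the decay estimate, `3 ^ d` by the count of displacements.
  refine ⟨16 + 3 ^ d, by positivity, fun R H hR hs hgap hxp => ?_⟩
  set c : ℝ := 16 + 3 ^ d with hc
  have hc16 : 16 ≤ c := by linarith
  have hpos := Krein.QBH.X_mul_P_pos hxp hs hgap
  obtain ⟨x, p, h, hV⟩ := Krein.QBH.exists_gappedPair hxp hs hgap
  have ha := h.left_pos
  have hb := h.symm.left_pos
  refine ⟨fun k => ⟨left_ne_zero_of_mul (hpos k).ne', right_ne_zero_of_mul (hpos k).ne', ?_⟩,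
    Krein.QBH.nonempty_bogoliubov hxp hpos, fun Q => ?_⟩
  · rw [← hV]
    exact div_pos (h.pos_left k) (h.pos_right k)
  have hΓ : Q.Γ = Krein.harmonicΓ (fun k => H.X k / H.P k) := by
    rw [Krein.QBH.Bogoliubov.Γ, Krein.harmonicΓ]
    congr 1
    funext k
    exact Krein.QBH.Bogoliubov.cov_eq hxp hpos Q k
  have hΓ' := hΓ.trans (h.harmonicΓ_eq hV)
  refine ⟨hΓ, ⟨by positivity, fun j j' => ⟨?_, ?_⟩⟩, fun ξ hξ B => ?_⟩
  · rw [hΓ', Matrix.fromBlocks_apply₁₁, Matrix.of_apply, mul_comm H.normHxx]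
    exact h.symm.abs_coeff_le hR hc16 _
  · rw [hΓ', Matrix.fromBlocks_apply₂₂, Matrix.of_apply]
    exact h.abs_coeff_le hR hc16 _
  · obtain ⟨hξ0, hξ⟩ := hξ
    set w := Real.exp (-1 / ξ) with hw
    have hw1 : w < 1 := by
      rw [hw, Real.exp_lt_one_iff]
      exact div_neg_of_neg_of_pos (by norm_num) hξ0
    -- Only the decay of the momentum correlations enters the entropy bound; the position block
    -- enters through its operator bound `2 ‖H_pp‖ / E`.
    have hκ : ∀ r, |Krein.coeff (fun k => Real.sqrt (x k / p k)) r| ≤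
        c * H.normHxx / H.kreinGap * w ^ Krein.len r := by
      intro r
      have := (hξ r 0).2
      rw [hΓ', Matrix.fromBlocks_apply₂₂, Matrix.of_apply, sub_zero] at this
      rw [hw, ← Real.exp_nat_mul]
      convert this using 3
      ring
    have hrestrict : Krein.restrict Q.Γ B = Matrix.fromBlocks
        (Krein.coeffMatrix (fun k => Real.sqrt (p k / x k)) B) 0 0
        (Krein.coeffMatrix (fun k => Real.sqrt (x k / p k)) B) := by
      rw [hΓ']
      ext i j
      rcases i with i | i <;> rcases j with j | j <;> rfl
    have hpoly : 0 ≤ Krein.polylog (1 - 2 * ((d + 1 : ℕ) : ℤ)) w :=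
      tsum_nonneg fun n => by positivity
    rw [Krein.entanglementEntropy, hrestrict]
    refine (h.entropy_le B (Real.exp_pos _).le hw1 hκ).trans ?_
    set L := Krein.polylog (1 - 2 * ((d + 1 : ℕ) : ℤ)) w
    calc 3 / 2 * (2 * H.normHpp / H.kreinGap * (c * H.normHxx / H.kreinGap *
          (2 * 3 ^ d * (Krein.area B : ℝ) * L)))
        = (6 * 3 ^ d) * c * (H.normHxx * H.normHpp) * L * (Krein.area B : ℝ) /
          H.kreinGap ^ 2 := by
          field_simp
          ring
      -- `6 · 3 ^ d ≤ 16 c` because `3 ^ d ≤ c`.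
      _ ≤ (16 * c) * c * (H.normHxx * H.normHpp) * L * (Krein.area B : ℝ) /
          H.kreinGap ^ 2 := by
          gcongr <;> linarith
      _ = _ := by ring
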